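/- **Factor regression model.** Let $(X,Y)\in\mathbb R^p\times\mathbb R$ satisfy $Y=Z^\top\beta+\varepsilon$ and $X=AZ+W$, where $A\in\mathbb R^{p\times K}$ and $\beta\in\mathbb R^K$ are deterministic, and $Z\in\mathbb R^K$, $W\in\mathbb R^p$, $\varepsilon\in\mathbb R$ are mutually independent, have mean zero, and satisfy $\mathbb E[ZZ^\top]=\Sigma_Z$, $\mathbb E[WW^\top]=\Sigma_W$, $\mathbb E[\varepsilon^2]=\sigma^2$, with $\operatorname{rank}(A)=\operatorname{rank}(\Sigma_Z)=K$. Assume moreover that, for constants $\gamma_\varepsilon,\gamma_z,\gamma_w>0$: $\varepsilon$ is $\sigma\gamma_\varepsilon$ sub-Gaussian; $Z=\Sigma_Z^{1/2}\widetilde Z$ with $\widetilde Z$ mean zero, $\gamma_z$ sub-Gaussian and $\mathbb E[\widetilde Z\widetilde Z^\top]=I_K$; $W=\Sigma_W^{1/2}\widetilde W$ with $\widetilde W$ mean zero, $\gamma_w$ sub-Gaussian and $\mathbb E[\widetilde W\widetilde W^\top]=I_p$. Here a mean-zero random variable $x$ is $\gamma$ sub-Gaussian if $\mathbb E[e^{tx}]\le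 e^{t^2\gamma^2/2}$ for all $t\in\mathbb R$, and a random vector is $\gamma$ sub-Gaussian if its inner product with every unit vector is. Let $n\ge 1$ and let $(X_1,Y_1),\dots,(X_n,Y_n)$ be independent copies of $(X,Y)$; let $\mathbf X\in\mathbb R^{n\times p}$ be the matrix with rows $X_i^\top$ and $\mathbf Y=(Y_1,\dots,Y_n)^\top$. With $\mathbf X^+$ the Moore–Penrose inverse, consider the predictor $\widehat Y_*=X_*^\top\mathbf X^+\mathbf Y$ of $Y_*$, and its risk $\mathcal R=\mathbb E_{(X_*,Y_*)}\big[(Y_*-X_*^\top\mathbf X^+\mathbf Y)^2\big]$, where the expectation is only over a new independent copy $(X_*,Y_*)$ of $(X,Y)$, so that $\mathcal R$ is a function of the data. Write $\|\cdot\|_{op}$ for the largest singular value and $r_e(\Sigma_W)=\operatorname{tr}(\Sigma_W)/\|\Sigma_W\|_{op}$. **Statement.** There are an absolute constant $c>0$, a constant $C>0$ depending only on $\gamma_z$, a constant $C'>0$ depending only on $\gamma_z,\gamma_w$, and a constant $D>0$ depending only on $\gamma_z,\gamma_w,\gamma_\varepsilon$ such that the following holds for all $n$, $p$ and $(K,A,\beta,\Sigma_Z,\Sigma_W,\sigma^2)$.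 If $K\log n\le Cn$, the entries of $\widetilde W$ are independent, and $r_e(\Sigma_W)>C'n$, then with probability at least $1-c/n$ over the data, $$\mathcal R-\sigma^2\le D\left[\frac{K+\log n}{n}\,\sigma^2+\frac{n}{r_e(\Sigma_W)}\,\sigma^2+\frac{r_e(\Sigma_W)}{n}\,\|\Sigma_W\|_{op}\,\beta^\top(A^\top A)^{-1}\beta\right].$$ -/

import Mathlib

open MeasureTheory ProbabilityTheory
open scoped Matrix

noncomputable section

namespace FactorRegression

/-- The Moore-Penrose inverse `M⁺ = (Mᵀ M)⁺ Mᵀ` of a real matrix; `(Mᵀ M)⁺` is obtained by applying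
`x ↦ x⁻¹` (with `0⁻¹ = 0`) to the eigenvalues of `Mᵀ M`. -/
def pinv {m p : ℕ} (M : Matrix (Fin m) (Fin p) ℝ) : Matrix (Fin p) (Fin m) ℝ :=
  cfc (fun x : ℝ => x⁻¹) (Mᵀ * M) * Mᵀ

/-- `pinv M` satisfies the four Penrose equations. -/
theorem pinv_penrose {m p : ℕ} (M : Matrix (Fin m) (Fin p) ℝ) :
    M * pinv M * M = M ∧ pinv M * M * pinv M = pinv M ∧
      (M * pinv M)ᵀ = M * pinv M ∧ (pinv M * M)ᵀ = pinv M * M := by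
  have hsa : IsSelfAdjoint (Mᵀ * M) := by
    simp [IsSelfAdjoint, Matrix.star_eq_conjTranspose, Matrix.conjTranspose_eq_transpose_of_trivial]
  have hc : ∀ f : ℝ → ℝ, ContinuousOn f (spectrum ℝ (Mᵀ * M)) :=
    fun f => (Matrix.finite_real_spectrum).continuousOn f
  set G := Mᵀ * M with hG
  set H := cfc (fun x : ℝ => x⁻¹) G with hH
  have hid : cfc (fun x : ℝ => x) G = G := cfc_id' ℝ G
  have hHt : Hᵀ = H := by
    have : IsSelfAdjoint H := cfc_predicate _ _
    simpa [IsSelfAdjoint, Matrix.star_eq_conjTranspose,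
      Matrix.conjTranspose_eq_transpose_of_trivial] using this
  have hGt : Gᵀ = G := by simp [hG]
  have hGH : G * H = H * G := by
    have h1 := cfc_mul (fun x : ℝ => x) (fun x : ℝ => x⁻¹) G (hc _) (hc _)
    have h2 := cfc_mul (fun x : ℝ => x⁻¹) (fun x : ℝ => x) G (hc _) (hc _)
    rw [hid] at h1 h2
    rw [← h1, ← h2]
    simp only [mul_comm]
  have hGHG : G * H * G = G := by
    have h1 := cfc_mul (fun x : ℝ => x) (fun x : ℝ => x⁻¹) G (hc _) (hc _)
    have h2 := cfc_mul (fun x : ℝ => x * x⁻¹) (fun x : ℝ => x) G (hc _) (hc _)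
    rw [hid] at h1 h2
    rw [← h1, ← h2]
    simp only [mul_inv_mul_cancel]
    exact hid
  have hHGH : H * G * H = H := by
    have h1 := cfc_mul (fun x : ℝ => x⁻¹) (fun x : ℝ => x) G (hc _) (hc _)
    have h2 := cfc_mul (fun x : ℝ => x⁻¹ * x) (fun x : ℝ => x⁻¹) G (hc _) (hc _)
    rw [hid] at h1
    rw [← h1, ← h2]
    have h3 : (fun x : ℝ => x⁻¹ * x * x⁻¹) = fun x => x⁻¹ := by
      funext x
      rcases eq_or_ne x 0 with rfl | hx
      · simp
      · rw [inv_mul_cancel₀ hx, one_mul]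
    rw [h3]
  have hp : pinv M = H * Mᵀ := rfl
  have hMHG : M * H * G = M := by
    have h0 : (M * H * G - M)ᴴ * (M * H * G - M) = 0 := by
      rw [Matrix.conjTranspose_eq_transpose_of_trivial]
      have : (M * H * G - M)ᵀ * (M * H * G - M)
          = G * H * G * H * G - G * H * G - G * H * G + G := by
        simp only [Matrix.transpose_sub, Matrix.transpose_mul, hHt, hG,
          Matrix.transpose_transpose]
        simp only [Matrix.sub_mul, Matrix.mul_sub, Matrix.mul_assoc]
        abel
      rw [this, hGHG, hGHG]
      abel
    exact sub_eq_zero.mp (Matrix.conjTranspose_mul_self_eq_zero.mp h0)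
  refine ⟨?_, ?_, ?_, ?_⟩
  · rw [hp, ← Matrix.mul_assoc, Matrix.mul_assoc (M * H), ← hG, hMHG]
  · rw [hp, Matrix.mul_assoc H, ← hG, ← Matrix.mul_assoc, hHGH]
  · rw [hp]
    simp [Matrix.transpose_mul, hHt, Matrix.mul_assoc]
  · rw [hp, Matrix.mul_assoc, ← hG, Matrix.transpose_mul, hHt, hGt, hGH]

/-- The operator norm (largest singular value) of a square matrix. -/
def opNorm {p : ℕ} (S : Matrix (Fin p) (Fin p) ℝ) : ℝ :=
  ‖Matrix.toEuclideanCLM (n := Fin p) (𝕜 := ℝ) S‖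

/-- The reduced effective rank `tr(S) / ‖S‖_op`. -/
def effRank {p : ℕ} (S : Matrix (Fin p) (Fin p) ℝ) : ℝ :=
  S.trace / opNorm S

/-- The parameter `θ = (K, A, β, Σ_Z, Σ_W, σ²)` of a factor regression model with `p` features. -/
structure Params (p : ℕ) where
  K : ℕ
  A : Matrix (Fin p) (Fin K) ℝ
  β : Fin K → ℝ
  SigmaZ : Matrix (Fin K) (Fin K) ℝ
  SigmaW : Matrix (Fin p) (Fin p) ℝ
  sigmaSq : ℝ

section Model

variable {Ω : Type*} [MeasurableSpace Ω]

/-- The random vector `x` is square integrable, has mean zero, and `E[x xᵀ] = S`. -/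
structure IsCenteredWithCov {d : ℕ} (x : Ω → Fin d → ℝ) (S : Matrix (Fin d) (Fin d) ℝ)
    (P : Measure Ω) : Prop where
  memLp : ∀ i, MemLp (fun ω => x ω i) 2 P
  mean_zero : ∀ i, ∫ ω, x ω i ∂P = 0
  second_moment : ∀ i j, ∫ ω, x ω i * x ω j ∂P = S i j

/-- `⟨x, v⟩` is `γ` sub-Gaussian for every unit vector `v`. (Mathlib's predicate takes the variance
proxy `γ²` as its parameter.) -/
def IsSubGaussianVector {d : ℕ} (x : Ω → Fin d → ℝ) (γ : ℝ) (P : Measure Ω) : Prop :=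
  ∀ v : Fin d → ℝ, v ⬝ᵥ v = 1 → HasSubgaussianMGF (fun ω => x ω ⬝ᵥ v) (γ ^ 2).toNNReal P

/-- `(X, Y)` follows the factor regression model with parameter `θ`, the latent factor, the feature
noise and the response noise being `Z`, `W` and `ε`. -/
structure IsFRM {p : ℕ} (θ : Params p) (X : Ω → Fin p → ℝ) (Y : Ω → ℝ)
    (Z : Ω → Fin θ.K → ℝ) (W : Ω → Fin p → ℝ) (ε : Ω → ℝ) (P : Measure Ω) : Prop where
  measurable_Z : Measurable Z
  measurable_W : Measurable W
  measurable_ε : Measurable ε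
  eq_Y : ∀ᵐ ω ∂P, Y ω = Z ω ⬝ᵥ θ.β + ε ω
  eq_X : ∀ᵐ ω ∂P, X ω = θ.A *ᵥ Z ω + W ω
  /-- Together with `indep_W_ε`: the triple `(Z, W, ε)` is mutually independent. -/
  indep_Z_Wε : IndepFun Z (fun ω => (W ω, ε ω)) P
  indep_W_ε : IndepFun W ε P
  cov_Z : IsCenteredWithCov Z θ.SigmaZ P
  cov_W : IsCenteredWithCov W θ.SigmaW P
  memLp_ε : MemLp ε 2 P
  mean_ε : ∫ ω, ε ω ∂P = 0
  var_ε : ∫ ω, ε ω ^ 2 ∂P = θ.sigmaSq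
  rank_A : θ.A.rank = θ.K
  rank_SigmaZ : θ.SigmaZ.rank = θ.K

open scoped MatrixOrder in
/-- `(X, Y)` follows the sub-Gaussian factor regression model with parameter `θ` and sub-Gaussian
constants `γε, γz, γw`; `Zt` and `Wt` are the standardized vectors with `Z = Σ_Z^{1/2} Zt` and
`W = Σ_W^{1/2} Wt`. -/
structure IsSubGaussianFRM {p : ℕ} (θ : Params p) (γε γz γw : ℝ)
    (X : Ω → Fin p → ℝ) (Y : Ω → ℝ) (Z Zt : Ω → Fin θ.K → ℝ) (W Wt : Ω → Fin p → ℝ) (ε : Ω → ℝ)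
    (P : Measure Ω) : Prop extends IsFRM θ X Y Z W ε P where
  measurable_Zt : Measurable Zt
  measurable_Wt : Measurable Wt
  /-- `ε` is `σ γε` sub-Gaussian. -/
  subGaussian_ε : HasSubgaussianMGF ε (θ.sigmaSq * γε ^ 2).toNNReal P
  eq_Z : ∀ᵐ ω ∂P, Z ω = CFC.sqrt θ.SigmaZ *ᵥ Zt ω
  subGaussian_Zt : IsSubGaussianVector Zt γz P
  cov_Zt : IsCenteredWithCov Zt 1 P
  eq_W : ∀ᵐ ω ∂P, W ω = CFC.sqrt θ.SigmaW *ᵥ Wt ω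
  subGaussian_Wt : IsSubGaussianVector Wt γw P
  cov_Wt : IsCenteredWithCov Wt 1 P

/-- The prediction risk `E[(Y_* - X_*ᵀ α)²]` of the linear predictor with coefficient vector `α`, the
expectation being over a new data point `(X_*, Y_*)` distributed as `(X, Y)` under `P`. -/
def risk {p : ℕ} (X : Ω → Fin p → ℝ) (Y : Ω → ℝ) (P : Measure Ω) (α : Fin p → ℝ) : ℝ :=
  ∫ ω, (Y ω - X ω ⬝ᵥ α) ^ 2 ∂P

/-- `(Xs i, Ys i)`, `i < n`, are `n` independent copies, defined on `(Ω', Q)`, of the pair `(X, Y)`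
defined on `(Ω, P)`. -/
structure IsSample {Ω' : Type*} [MeasurableSpace Ω'] {n p : ℕ}
    (Xs : Fin n → Ω' → Fin p → ℝ) (Ys : Fin n → Ω' → ℝ) (Q : Measure Ω')
    (X : Ω → Fin p → ℝ) (Y : Ω → ℝ) (P : Measure Ω) : Prop where
  indep : iIndepFun (fun i ω => (Xs i ω, Ys i ω)) Q
  identDistrib : ∀ i, IdentDistrib (fun ω => (Xs i ω, Ys i ω)) (fun ω => (X ω, Y ω)) Q P

end Model

/-- The coefficient vector `𝐗⁺ 𝐘` of the generalized least squares (minimum-norm) predictor; the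
rows of `𝐗` are the observed feature vectors. -/
def glsCoef {n p : ℕ} (x : Fin n → Fin p → ℝ) (y : Fin n → ℝ) : Fin p → ℝ :=
  pinv (Matrix.of x) *ᵥ y

end FactorRegression

end

/-! Write α = x⁺y for the fitted coefficients, x = zAᵀ + w for the feature matrix, y = zβ + e and δ
= β - Aᵀα. A fresh residual is ⟨Z, δ⟩ - ⟨W, α⟩ + ε, a sum of uncorrelated terms, so the excess risk
is δᵀΣ_Z δ + αᵀΣ_W α (`risk_sub_eq_excess`).

The feature noise acts as a ridge penalty of size tr Σ_W. When r_e(Σ_W) is much larger than n, all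
squared singular values of w are of order tr Σ_W, even after its rows are projected off the columns
of A. This projection removes the signal zAᵀ, so xxᵀ ≥ a with a of order tr Σ_W, whatever z is
(`lower_bound_features`). Hence x has full row rank and the predictor interpolates: xα = y, that is,
zδ = wα - e.

The rest is deterministic (`excess_le`). With b = A(AᵀA)⁻¹β one has zβ = xb - wb, so the signal part
of α has squared norm of order |b|² = βᵀ(AᵀA)⁻¹β, while the noise part has squared norm at most
|e|²/a. Multiplied by ‖Σ_W‖, these account for αᵀΣ_W α. For the other term, zᵀz is at least of order
nΣ_Z, so |zδ|²/n controls δᵀΣ_Z δ. Bounding e crudely there would cost a full σ²; but zδ lies in the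
K-dimensional column space of z, and projecting zδ = wα - e onto it leaves a quadratic form in e of
trace O(K) (`noiseForm_bounds`). Its upper tail at level log n gives the rate (K + log n)/n.

The spectral bounds hold with high probability by a net argument (`measure_not_wellConditioned_le`).
On each net point the squared norm is a quadratic form in independent sub-Gaussian variables. Its
upper tail comes from Gaussian linearization, its lower tail from a fourth-moment bound for the
diagonal and decoupling for the rest (`quadratic_lower_tail`). Finally the sample is replaced by a
product of the latent laws, and the three failure probabilities are added by Fubini
(`one_sub_le_measure_risk`). -/

namespace FactorRegression

/-! ### Exponential moments of quadratic forms by Gaussian linearization. -/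

section QuadraticForms

variable {Ω : Type*} [MeasurableSpace Ω] {ι : Type*} [Fintype ι]

/-- The exponential moments of `⟨x, v⟩` are dominated by those of a centred Gaussian vector with
covariance `g • 1`. -/
def SubGaussianMoments (x : Ω → ι → ℝ) (g : ℝ) (P : Measure Ω) : Prop :=
  ∀ v : ι → ℝ, ∫⁻ ω, ENNReal.ofReal (Real.exp (x ω ⬝ᵥ v)) ∂P ≤
    ENNReal.ofReal (Real.exp (g * (v ⬝ᵥ v) / 2))

theorem lintegral_exp_mul_gaussianReal (t : ℝ) :
    ∫⁻ y, ENNReal.ofReal (Real.exp (t * y)) ∂gaussianReal 0 1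
      = ENNReal.ofReal (Real.exp (t ^ 2 / 2)) := by
  rw [← ofReal_integral_eq_lintegral_ofReal (integrable_exp_mul_gaussianReal t)
    (ae_of_all _ fun _ => (Real.exp_pos _).le)]
  have := congrFun (mgf_fun_id_gaussianReal (μ := 0) (v := 1)) t
  simp only [mgf] at this
  rw [this]
  simp

theorem lintegral_exp_sq_gaussianReal_le {a : ℝ} (h0 : 0 ≤ a) (h1 : a ≤ 1 / 4) :
    ∫⁻ y, ENNReal.ofReal (Real.exp (a * y ^ 2)) ∂gaussianReal 0 1
      ≤ ENNReal.ofReal (Real.exp (2 * a)) := by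
  rw [gaussianReal_of_var_ne_zero _ one_ne_zero,
    lintegral_withDensity_eq_lintegral_mul _ (measurable_gaussianPDF 0 1) (by fun_prop)]
  have hb : 0 < 1 / 2 - a := by linarith
  have hint : Integrable (fun y : ℝ => (√(2 * Real.pi))⁻¹ * Real.exp (-(1 / 2 - a) * y ^ 2)) :=
    (integrable_exp_neg_mul_sq hb).const_mul _
  have heq : ∀ y : ℝ, (gaussianPDF 0 1 * fun y => ENNReal.ofReal (Real.exp (a * y ^ 2))) y
      = ENNReal.ofReal ((√(2 * Real.pi))⁻¹ * Real.exp (-(1 / 2 - a) * y ^ 2)) := by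
    intro y
    simp only [Pi.mul_apply, gaussianPDF, gaussianPDFReal]
    rw [← ENNReal.ofReal_mul (by positivity), mul_assoc, ← Real.exp_add]
    congr 3
    · simp
    · simp; ring
  rw [lintegral_congr heq, ← ofReal_integral_eq_lintegral_ofReal hint
    (ae_of_all _ fun _ => by positivity), integral_const_mul, integral_gaussian]
  apply ENNReal.ofReal_le_ofReal
  rw [← Real.sqrt_inv, ← Real.sqrt_mul (by positivity), Real.sqrt_le_left (by positivity),
    ← Real.exp_nat_mul]
  have hpi := Real.pi_pos
  have h2 : (2 * Real.pi)⁻¹ * (Real.pi / (1 / 2 - a)) = 1 / (1 - 2 * a) := by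
    have : 1 - 2 * a ≠ 0 := by linarith
    have : 1 - a * 2 ≠ 0 := by linarith
    field_simp
  rw [h2, div_le_iff₀ (by linarith)]
  -- The integral is (1 - 2a)^(-1/2), and (1 - 2a)e^{4a} ≥ (1 - 2a)(1 + 4a) = 1 + 2a(1 - 4a) ≥ 1
  -- exactly because a ≤ 1/4.
  have h3 := Real.add_one_le_exp (((2 : ℕ) : ℝ) * (2 * a))
  push_cast at h3 ⊢
  nlinarith

theorem exists_eigen_decomposition [DecidableEq ι] {M : Matrix ι ι ℝ} (hM : M.PosSemidef) {L : ℝ}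
    (hL : ∀ x, x ⬝ᵥ M *ᵥ x ≤ L * (x ⬝ᵥ x)) :
    ∃ (μ : ι → ℝ) (u : ι → ι → ℝ), (∀ k, 0 ≤ μ k ∧ μ k ≤ L) ∧ ∑ k, μ k = M.trace ∧
      (∀ x, x ⬝ᵥ M *ᵥ x = ∑ k, μ k * (x ⬝ᵥ u k) ^ 2) ∧
      ∀ c : ι → ℝ, (∑ k, c k • u k) ⬝ᵥ (∑ k, c k • u k) = ∑ k, c k ^ 2 := by
  have hH := hM.isHermitian
  set b := hH.eigenvectorBasis
  set μ := hH.eigenvalues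
  have hin : ∀ x y : EuclideanSpace ℝ ι, inner ℝ x y = x.ofLp ⬝ᵥ y.ofLp := by
    intro x y
    simp [EuclideanSpace.inner_eq_star_dotProduct, dotProduct_comm]
  have hMu : ∀ k, M *ᵥ (b k).ofLp = μ k • (b k).ofLp := fun k => by
    simpa using hH.mulVec_eigenvectorBasis k
  have hbk : ∀ k, (b k).ofLp ⬝ᵥ (b k).ofLp = 1 := by
    intro k
    rw [← hin, real_inner_self_eq_norm_sq, b.orthonormal.1 k]; norm_num
  have hbkl : ∀ k l, (b k).ofLp ⬝ᵥ (b l).ofLp = if k = l then 1 else 0 := by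
    intro k l
    rw [← hin]
    exact orthonormal_iff_ite.1 b.orthonormal k l
  have hsymm : ∀ x y, x ⬝ᵥ M *ᵥ y = (M *ᵥ x) ⬝ᵥ y := by
    intro x y
    have : Mᵀ = M := by
      rw [← Matrix.conjTranspose_eq_transpose_of_trivial]; exact hH
    rw [Matrix.dotProduct_mulVec, ← Matrix.mulVec_transpose, this]
  refine ⟨μ, fun k => (b k).ofLp, fun k => ⟨hM.eigenvalues_nonneg k, ?_⟩, ?_, ?_, ?_⟩
  · have := hL (b k).ofLp
    rw [hMu, dotProduct_smul, hbk] at this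
    simpa using this
  · simpa using hH.trace_eq_sum_eigenvalues.symm
  · intro x
    have hx : x = ∑ k, (x ⬝ᵥ (b k).ofLp) • (b k).ofLp := by
      have := b.sum_repr (WithLp.toLp 2 x)
      have h2 := congrArg WithLp.ofLp this
      simp only [WithLp.ofLp_sum, WithLp.ofLp_smul] at h2
      rw [← h2]
      refine Finset.sum_congr rfl fun k _ => ?_
      rw [b.repr_apply_apply, hin, h2, dotProduct_comm]
    have hMx : M *ᵥ x = ∑ k, (μ k * (x ⬝ᵥ (b k).ofLp)) • (b k).ofLp := by
      conv_lhs => rw [hx]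
      rw [Matrix.mulVec_sum]
      refine Finset.sum_congr rfl fun k _ => ?_
      rw [Matrix.mulVec_smul, hMu, smul_smul, mul_comm]
    rw [hMx, dotProduct_sum]
    refine Finset.sum_congr rfl fun k _ => ?_
    rw [dotProduct_smul, smul_eq_mul]; ring
  · intro c
    rw [sum_dotProduct]
    refine Finset.sum_congr rfl fun k _ => ?_
    rw [dotProduct_sum]
    simp only [smul_dotProduct, dotProduct_smul, hbkl, smul_eq_mul]
    simp [pow_two]

/-- e^{s xᵀMx} is the Laplace transform at x of a Gaussian vector with covariance 2sM. After
exchanging the two integrals, the hypothesis on x applies to a linear functional, and what remains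
is a Gaussian integral that factors over the eigenbasis. Independence of the coordinates of x plays
no role. -/
theorem lintegral_exp_quadratic_le [DecidableEq ι] {P : Measure Ω} [IsProbabilityMeasure P]
    {x : Ω → ι → ℝ} (hxm : Measurable x) {g : ℝ} (hx : SubGaussianMoments x g P)
    {M : Matrix ι ι ℝ} (hM : M.PosSemidef) {L : ℝ}
    (hL : ∀ y, y ⬝ᵥ M *ᵥ y ≤ L * (y ⬝ᵥ y)) {s : ℝ} (hs : 0 ≤ s) (hg : 0 ≤ g)
    (hsL : s * g * L ≤ 1 / 4) :
    ∫⁻ ω, ENNReal.ofReal (Real.exp (s * (x ω ⬝ᵥ M *ᵥ x ω))) ∂P ≤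
      ENNReal.ofReal (Real.exp (2 * s * g * M.trace)) := by
  obtain ⟨μ, u, hμ, htr, hquad, hort⟩ := exists_eigen_decomposition hM hL
  set γ : Measure (ι → ℝ) := Measure.pi fun _ => gaussianReal 0 1
  have hind : ∀ f : ι → ℝ → ENNReal, (∀ k, Measurable (f k)) →
      ∫⁻ y, ∏ k, f k (y k) ∂γ = ∏ k, ∫⁻ t, f k t ∂gaussianReal 0 1 := by
    intro f hf
    rw [lintegral_prod_eq_prod_lintegral_of_indepFun Finset.univ (fun k (y : ι → ℝ) => f k (y k))
      (iIndepFun_pi fun k => (hf k).aemeasurable) (fun k => (hf k).comp (measurable_pi_apply k))]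
    refine Finset.prod_congr rfl fun k _ => ?_
    exact (measurePreserving_eval (fun _ => gaussianReal 0 1) k).lintegral_comp (hf k)
  -- Under the standard Gaussian `γ`, the vector `w` is centred with covariance 2sM.
  set w : (ι → ℝ) → (ι → ℝ) := fun y => ∑ k, (√(2 * s * μ k) * y k) • u k
  have hwm : Measurable w := by fun_prop
  have h1 : ∀ z : ι → ℝ, ENNReal.ofReal (Real.exp (s * (z ⬝ᵥ M *ᵥ z)))
      = ∫⁻ y, ENNReal.ofReal (Real.exp (z ⬝ᵥ w y)) ∂γ := by
    intro z
    have h2 : ∀ y, ENNReal.ofReal (Real.exp (z ⬝ᵥ w y))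
        = ∏ k, ENNReal.ofReal (Real.exp ((√(2 * s * μ k) * (z ⬝ᵥ u k)) * y k)) := by
      intro y
      rw [← ENNReal.ofReal_prod_of_nonneg fun _ _ => (Real.exp_pos _).le, ← Real.exp_sum]
      congr 2
      simp only [w, dotProduct_sum, dotProduct_smul, smul_eq_mul]
      exact Finset.sum_congr rfl fun k _ => by ring
    simp_rw [h2]
    rw [hind (fun k t => ENNReal.ofReal (Real.exp ((√(2 * s * μ k) * (z ⬝ᵥ u k)) * t)))
      (fun k => by fun_prop)]
    simp_rw [lintegral_exp_mul_gaussianReal]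
    rw [← ENNReal.ofReal_prod_of_nonneg fun _ _ => (Real.exp_pos _).le, ← Real.exp_sum, hquad,
      Finset.mul_sum]
    congr 2
    refine Finset.sum_congr rfl fun k _ => ?_
    rw [mul_pow, Real.sq_sqrt (mul_nonneg (by positivity) (hμ k).1)]
    ring
  simp_rw [h1]
  rw [lintegral_lintegral_swap (by
    apply Measurable.aemeasurable
    have : Measurable fun q : Ω × (ι → ℝ) => x q.1 ⬝ᵥ w q.2 := by
      simp only [dotProduct]
      fun_prop
    exact this.exp.ennreal_ofReal)]
  calc ∫⁻ y, ∫⁻ ω, ENNReal.ofReal (Real.exp (x ω ⬝ᵥ w y)) ∂P ∂γ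
      ≤ ∫⁻ y, ∏ k, ENNReal.ofReal (Real.exp ((s * g * μ k) * y k ^ 2)) ∂γ := by
        refine lintegral_mono fun y => (hx (w y)).trans (le_of_eq ?_)
        rw [← ENNReal.ofReal_prod_of_nonneg fun _ _ => (Real.exp_pos _).le, ← Real.exp_sum, hort,
          Finset.mul_sum, Finset.sum_div]
        congr 2
        refine Finset.sum_congr rfl fun k _ => ?_
        rw [mul_pow, Real.sq_sqrt (mul_nonneg (by positivity) (hμ k).1)]
        ring
    _ = ∏ k, ∫⁻ t, ENNReal.ofReal (Real.exp ((s * g * μ k) * t ^ 2)) ∂gaussianReal 0 1 :=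
        hind (fun k t => ENNReal.ofReal (Real.exp ((s * g * μ k) * t ^ 2))) (fun k => by fun_prop)
    _ ≤ ∏ k, ENNReal.ofReal (Real.exp (2 * (s * g * μ k))) := by
        refine Finset.prod_le_prod' fun k _ => lintegral_exp_sq_gaussianReal_le
          (mul_nonneg (mul_nonneg hs hg) (hμ k).1) ?_
        exact (mul_le_mul_of_nonneg_left (hμ k).2 (mul_nonneg hs hg)).trans hsL
    _ = _ := by
        rw [← ENNReal.ofReal_prod_of_nonneg fun _ _ => (Real.exp_pos _).le, ← Real.exp_sum, ← htr,
          Finset.mul_sum]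
        congr 2
        exact Finset.sum_congr rfl fun k _ => by ring

end QuadraticForms

theorem posSemidef_transpose_eq {ι : Type*} {M : Matrix ι ι ℝ} (hM : M.PosSemidef) : Mᵀ = M := by
  rw [← Matrix.conjTranspose_eq_transpose_of_trivial]; exact hM.isHermitian

/-! ### Decoupling and the off-diagonal part of a quadratic form. -/

section HansonWright

variable {Ω : Type*} [MeasurableSpace Ω] {ι : Type*} [Fintype ι] {P : Measure Ω}

theorem measure_lt_le_of_lintegral_exp_le {f : Ω → ℝ} (hf : Measurable f) {t a : ℝ}
    (h : ∫⁻ ω, ENNReal.ofReal (Real.exp (f ω)) ∂P ≤ ENNReal.ofReal (Real.exp a)) :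
    P {ω | t < f ω} ≤ ENNReal.ofReal (Real.exp (a - t)) := by
  have h1 := mul_meas_ge_le_lintegral (μ := P) (f := fun ω => ENNReal.ofReal (Real.exp (f ω)))
    (by fun_prop) (ENNReal.ofReal (Real.exp t))
  have h2 : ENNReal.ofReal (Real.exp t) * P {ω | t < f ω} ≤ ENNReal.ofReal (Real.exp a) := by
    refine le_trans ?_ (h1.trans h)
    gcongr
    intro hω
    exact ENNReal.ofReal_le_ofReal (Real.exp_le_exp.2 (le_of_lt hω))
  rw [Real.exp_sub, ENNReal.ofReal_div_of_pos (Real.exp_pos _), ENNReal.le_div_iff_mul_le, mul_comm]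
  · exact h2
  · left; simp [Real.exp_pos]
  · left; simp

theorem SubGaussianMoments.mono {x : Ω → ι → ℝ} {g g' : ℝ} (hx : SubGaussianMoments x g P)
    (h : g ≤ g') : SubGaussianMoments x g' P := fun v => (hx v).trans <| by
  have : 0 ≤ v ⬝ᵥ v := dotProduct_self_star_nonneg v
  gcongr

theorem SubGaussianMoments.mul_left {x : Ω → ι → ℝ} {g : ℝ} (hx : SubGaussianMoments x g P)
    (hg : 0 ≤ g) {a : ι → ℝ} (ha : ∀ i, a i ^ 2 ≤ 1) :
    SubGaussianMoments (fun ω => a * x ω) g P := by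
  intro v
  have h1 : ∀ ω, (a * x ω) ⬝ᵥ v = x ω ⬝ᵥ (a * v) := fun ω =>
    Finset.sum_congr rfl fun i _ => by simp only [Pi.mul_apply]; ring
  simp_rw [h1]
  refine (hx _).trans ?_
  gcongr
  refine Finset.sum_le_sum fun i _ => ?_
  simp only [Pi.mul_apply]
  nlinarith [mul_self_nonneg (v i), ha i]

theorem subGaussianMoments_of_iIndepFun {x : Ω → ι → ℝ} {c : NNReal}
    (hind : iIndepFun (fun i ω => x ω i) P)
    (h : ∀ i, HasSubgaussianMGF (fun ω => x ω i) c P) :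
    SubGaussianMoments x c P := by
  have := hind.isProbabilityMeasure
  intro v
  have hs := HasSubgaussianMGF.sum_of_iIndepFun (X := fun i ω => v i * x ω i) (s := Finset.univ)
    (hind.comp (fun i t => v i * t) (fun i => by fun_prop)) (fun i _ => (h i).const_mul (v i))
  have h1 : ∀ ω, x ω ⬝ᵥ v = 1 * ∑ i, v i * x ω i := fun ω => by
    rw [one_mul]; exact Finset.sum_congr rfl fun i _ => mul_comm _ _
  simp_rw [h1]
  rw [← ofReal_integral_eq_lintegral_ofReal (hs.integrable_exp_mul 1)
    (ae_of_all _ fun _ => (Real.exp_pos _).le)]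
  refine ENNReal.ofReal_le_ofReal ((hs.mgf_le 1).trans (le_of_eq ?_))
  congr 1
  push_cast
  simp only [dotProduct, Finset.mul_sum, Finset.sum_div, Finset.sum_mul]
  refine Finset.sum_congr rfl fun i _ => ?_
  change v i ^ 2 * (c : ℝ) * 1 ^ 2 / 2 = _
  ring

section Deterministic

variable {M : Matrix ι ι ℝ} {L : ℝ}

theorem posSemidef_dotProduct_nonneg (hM : M.PosSemidef) (x : ι → ℝ) : 0 ≤ x ⬝ᵥ M *ᵥ x := by
  simpa using hM.dotProduct_mulVec_nonneg x

theorem dotProduct_mulVec_comm (hM : Mᵀ = M) (x y : ι → ℝ) : x ⬝ᵥ M *ᵥ y = y ⬝ᵥ M *ᵥ x := by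
  rw [Matrix.dotProduct_mulVec, ← Matrix.mulVec_transpose, hM, dotProduct_comm]

/-- M² ≤ L M without diagonalizing: test positivity of M on Lv - Mv and bound the term cubic in M by
`hL` at Mv. -/
theorem mulVec_dotProduct_mulVec_le (hM : M.PosSemidef) (hL0 : 0 < L)
    (hL : ∀ x, x ⬝ᵥ M *ᵥ x ≤ L * (x ⬝ᵥ x)) (v : ι → ℝ) :
    (M *ᵥ v) ⬝ᵥ (M *ᵥ v) ≤ L * (v ⬝ᵥ M *ᵥ v) := by
  have h := posSemidef_dotProduct_nonneg hM (L • v - M *ᵥ v)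
  have h2 := hL (M *ᵥ v)
  have h3 := dotProduct_mulVec_comm (posSemidef_transpose_eq hM) v (M *ᵥ v)
  rw [Matrix.mulVec_sub, Matrix.mulVec_smul, sub_dotProduct, dotProduct_sub, dotProduct_sub,
    smul_dotProduct, smul_dotProduct, dotProduct_smul, dotProduct_smul] at h
  simp only [smul_eq_mul] at h
  rw [h3] at h
  have h4 : 0 ≤ L * (L * (v ⬝ᵥ M *ᵥ v) - (M *ᵥ v) ⬝ᵥ (M *ᵥ v)) := by nlinarith
  have := nonneg_of_mul_nonneg_right h4 hL0
  linarith

theorem diag_eq_dotProduct [DecidableEq ι] (N : Matrix ι ι ℝ) (i : ι) :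
    N i i = Pi.single i 1 ⬝ᵥ N *ᵥ Pi.single i 1 := by
  simp

theorem trace_mul_self_le [DecidableEq ι] (hM : M.PosSemidef) (hL0 : 0 < L)
    (hL : ∀ x, x ⬝ᵥ M *ᵥ x ≤ L * (x ⬝ᵥ x)) : (Mᵀ * M).trace ≤ L * M.trace := by
  simp only [Matrix.trace, Matrix.diag, Finset.mul_sum]
  refine Finset.sum_le_sum fun i _ => ?_
  have := mulVec_dotProduct_mulVec_le hM hL0 hL (Pi.single i 1)
  rw [← diag_eq_dotProduct] at this
  refine le_trans (le_of_eq ?_) this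
  simp [Matrix.mul_apply, dotProduct]

end Deterministic

theorem sum_bool_eq_zero_of_flip [DecidableEq ι] (i : ι) (F : (ι → Bool) → ℝ)
    (hF : ∀ σ, F (Function.update σ i (!σ i)) = -F σ) : ∑ σ, F σ = 0 := by
  have hinv : Function.Involutive (fun σ : ι → Bool => Function.update σ i (!σ i)) := by
    intro σ; simp
  have h := Equiv.sum_comp hinv.toPerm F
  simp only [Function.Involutive.coe_toPerm, hF, Finset.sum_neg_distrib] at h
  linarith

/-- A uniform random subset contains i and misses j with probability 1/4. Expanding both indicators
in signs, every nonconstant term is odd under flipping one coordinate and cancels. -/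
theorem sum_bool_ite_mul_ite [DecidableEq ι] {i j : ι} (hij : i ≠ j) :
    ∑ σ : ι → Bool, (if σ i then (1 : ℝ) else 0) * (if σ j then 0 else 1)
      = Fintype.card (ι → Bool) / 4 := by
  set s : (ι → Bool) → ι → ℝ := fun σ k => if σ k then 1 else -1
  have h1 : ∀ σ : ι → Bool, (if σ i then (1 : ℝ) else 0) * (if σ j then 0 else 1)
      = 1 / 4 + s σ i / 4 - s σ j / 4 - s σ i * s σ j / 4 := by
    intro σ
    simp only [s]
    cases σ i <;> cases σ j <;> norm_num
  have hs : ∀ k, ∑ σ, s σ k = 0 := fun k => sum_bool_eq_zero_of_flip k _ fun σ => by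
    simp only [s, Function.update_self]; cases σ k <;> simp
  have hss : ∑ σ, s σ i * s σ j = 0 := sum_bool_eq_zero_of_flip i _ fun σ => by
    simp only [s, Function.update_self, Function.update_of_ne hij.symm]; cases σ i <;> simp <;>
      split_ifs <;> simp
  simp_rw [h1]
  rw [Finset.sum_sub_distrib, Finset.sum_sub_distrib, Finset.sum_add_distrib, ← Finset.sum_div,
    ← Finset.sum_div, ← Finset.sum_div, ← Finset.sum_div, hs, hs, hss]
  simp

/-- The off-diagonal part of a quadratic form is the average of its decoupled versions. -/
theorem sum_decoupled [DecidableEq ι] (M : Matrix ι ι ℝ) (x : ι → ℝ) :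
    ∑ σ : ι → Bool, ((fun i => if σ i then (1 : ℝ) else 0) * x) ⬝ᵥ
        M *ᵥ ((fun j => if σ j then (0 : ℝ) else 1) * x)
      = Fintype.card (ι → Bool) / 4 * (x ⬝ᵥ M *ᵥ x - ∑ i, M i i * x i ^ 2) := by
  have h1 : x ⬝ᵥ M *ᵥ x - ∑ i, M i i * x i ^ 2
      = ∑ i, ∑ j, if i = j then 0 else x i * M i j * x j := by
    simp only [dotProduct, Matrix.mulVec, ← Finset.sum_sub_distrib, Finset.mul_sum]
    refine Finset.sum_congr rfl fun i _ => ?_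
    rw [← Finset.add_sum_erase _ _ (Finset.mem_univ i), ← Finset.add_sum_erase (a := i) _ _
      (Finset.mem_univ i)]
    simp only [if_true, zero_add]
    rw [show x i * (M i i * x i) = M i i * x i ^ 2 by ring, add_sub_cancel_left]
    refine Finset.sum_congr rfl fun j hj => ?_
    rw [if_neg (Finset.ne_of_mem_erase hj).symm]; ring
  rw [h1]
  simp only [dotProduct, Matrix.mulVec, Finset.mul_sum, Pi.mul_apply]
  rw [Finset.sum_comm]
  refine Finset.sum_congr rfl fun i _ => ?_
  rw [Finset.sum_comm]
  refine Finset.sum_congr rfl fun j _ => ?_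
  by_cases hij : i = j
  · subst hij
    simp only [if_true, mul_zero]
    refine Finset.sum_eq_zero fun σ _ => ?_
    cases σ i <;> simp
  · rw [if_neg hij, ← sum_bool_ite_mul_ite hij, Finset.sum_mul]
    exact Finset.sum_congr rfl fun σ _ => by ring

/-- The two masked vectors are functions of disjoint blocks of coordinates. -/
theorem indepFun_mask [DecidableEq ι] {ξ : Ω → ι → ℝ} (hξ : Measurable ξ)
    (hind : iIndepFun (fun i ω => ξ ω i) P) (σ : ι → Bool) :
    IndepFun (fun ω => (fun i => if σ i then (1 : ℝ) else 0) * ξ ω)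
      (fun ω => (fun j => if σ j then (0 : ℝ) else 1) * ξ ω) P := by
  have hm : ∀ i, Measurable fun ω => ξ ω i := fun i => (measurable_pi_apply i).comp hξ
  set S : Finset ι := Finset.univ.filter fun i => σ i = true
  set T : Finset ι := Finset.univ.filter fun i => ¬ σ i = true
  have h := hind.indepFun_finset S T (Finset.disjoint_filter_filter_not _ _ _) hm
  have e : ∀ R : Finset ι, Measurable
      (fun (r : R → ℝ) (i : ι) => if h : i ∈ R then r ⟨i, h⟩ else 0) := by
    intro R
    refine measurable_pi_lambda _ fun i => ?_
    by_cases h : i ∈ R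
    · simp only [h, dite_true]; fun_prop
    · simp only [h, dite_false]; fun_prop
  have h2 := h.comp (e S) (e T)
  convert! h2 using 1
  · funext ω i
    simp only [Pi.mul_apply, Function.comp, S, Finset.mem_filter, Finset.mem_univ, true_and]
    cases σ i <;> simp
  · funext ω i
    simp only [Pi.mul_apply, Function.comp, T, Finset.mem_filter, Finset.mem_univ, true_and]
    cases σ i <;> simp

/-- Integrating over U with V fixed leaves the exponential of (g s²/2)|MV|², a quadratic form in V
with matrix MᵀM ≤ L², to which the linearization bound applies; `hs` is its smallness condition. -/
theorem lintegral_exp_bilinear_le [DecidableEq ι] [IsProbabilityMeasure P] {U V : Ω → ι → ℝ}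
    (hUm : Measurable U) (hVm : Measurable V) (hind : IndepFun U V P) {g : ℝ} (hg : 0 ≤ g)
    (hU : SubGaussianMoments U g P) (hV : SubGaussianMoments V g P)
    {M : Matrix ι ι ℝ} (hM : M.PosSemidef) {L : ℝ} (hL0 : 0 < L)
    (hL : ∀ x, x ⬝ᵥ M *ᵥ x ≤ L * (x ⬝ᵥ x)) {s : ℝ} (hs : s ^ 2 * g ^ 2 * L ^ 2 ≤ 1 / 2) :
    ∫⁻ ω, ENNReal.ofReal (Real.exp (s * (U ω ⬝ᵥ M *ᵥ V ω))) ∂P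
      ≤ ENNReal.ofReal (Real.exp (s ^ 2 * g ^ 2 * L * M.trace)) := by
  have hFm : Measurable fun q : (ι → ℝ) × (ι → ℝ) =>
      ENNReal.ofReal (Real.exp (s * (q.1 ⬝ᵥ M *ᵥ q.2))) := by
    have : Measurable fun q : (ι → ℝ) × (ι → ℝ) => q.1 ⬝ᵥ M *ᵥ q.2 := by
      simp only [dotProduct, Matrix.mulVec]; fun_prop
    fun_prop
  have hlaw := hind.map_prod_eq_prod_map_map hUm.aemeasurable hVm.aemeasurable
  have h1 : ∫⁻ ω, ENNReal.ofReal (Real.exp (s * (U ω ⬝ᵥ M *ᵥ V ω))) ∂P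
      = ∫⁻ q, ENNReal.ofReal (Real.exp (s * (q.1 ⬝ᵥ M *ᵥ q.2))) ∂((P.map U).prod (P.map V)) := by
    rw [← hlaw, lintegral_map hFm (hUm.prodMk hVm)]
  have : IsProbabilityMeasure (P.map U) := Measure.isProbabilityMeasure_map hUm.aemeasurable
  have : IsProbabilityMeasure (P.map V) := Measure.isProbabilityMeasure_map hVm.aemeasurable
  have hMM : (Mᵀ * M).PosSemidef := by
    have := Matrix.posSemidef_conjTranspose_mul_self M
    rwa [Matrix.conjTranspose_eq_transpose_of_trivial] at this
  have hMMv : ∀ v, v ⬝ᵥ (Mᵀ * M) *ᵥ v = (M *ᵥ v) ⬝ᵥ (M *ᵥ v) := fun v => by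
    rw [← Matrix.mulVec_mulVec, Matrix.dotProduct_mulVec v Mᵀ, Matrix.vecMul_transpose]
  rw [h1, lintegral_prod_symm _ hFm.aemeasurable]
  calc _ ≤ ∫⁻ v, ENNReal.ofReal (Real.exp ((g * s ^ 2 / 2) * (v ⬝ᵥ (Mᵀ * M) *ᵥ v)))
        ∂(P.map V) := by
        refine lintegral_mono fun v => ?_
        have hm : Measurable fun u : ι → ℝ => ENNReal.ofReal (Real.exp (s * (u ⬝ᵥ M *ᵥ v))) := by
          have : Measurable fun u : ι → ℝ => u ⬝ᵥ M *ᵥ v := by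
            simp only [dotProduct]; fun_prop
          fun_prop
        have e1 : ∀ ω, s * (U ω ⬝ᵥ M *ᵥ v) = U ω ⬝ᵥ s • (M *ᵥ v) := fun ω => by
          rw [dotProduct_smul, smul_eq_mul]
        have e2 : g * ((s • (M *ᵥ v)) ⬝ᵥ (s • (M *ᵥ v))) / 2
            = g * s ^ 2 / 2 * (v ⬝ᵥ (Mᵀ * M) *ᵥ v) := by
          rw [hMMv, dotProduct_smul, smul_dotProduct, smul_eq_mul, smul_eq_mul]; ring
        change ∫⁻ u, ENNReal.ofReal (Real.exp (s * (u ⬝ᵥ M *ᵥ v))) ∂_ ≤ _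
        rw [lintegral_map hm hUm, ← e2]
        simp_rw [e1]
        exact hU (s • (M *ᵥ v))
    _ = ∫⁻ ω, ENNReal.ofReal (Real.exp ((g * s ^ 2 / 2) * (V ω ⬝ᵥ (Mᵀ * M) *ᵥ V ω))) ∂P := by
        refine lintegral_map ?_ hVm
        have : Measurable fun q : ι → ℝ => q ⬝ᵥ (Mᵀ * M) *ᵥ q := by
          simp only [dotProduct, Matrix.mulVec]; fun_prop
        fun_prop
    _ ≤ ENNReal.ofReal (Real.exp (2 * (g * s ^ 2 / 2) * g * (Mᵀ * M).trace)) := by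
        refine lintegral_exp_quadratic_le hVm hV hMM (L := L ^ 2) ?_ (by positivity) hg (by linarith)
        intro y
        rw [hMMv]
        have h3 := mulVec_dotProduct_mulVec_le hM hL0 hL y
        nlinarith [hL y]
    _ ≤ _ := by
        refine ENNReal.ofReal_le_ofReal (Real.exp_le_exp.2 ?_)
        have := mul_le_mul_of_nonneg_left (trace_mul_self_le hM hL0 hL)
          (show 0 ≤ s ^ 2 * g ^ 2 by positivity)
        linarith

/-- The off-diagonal part is four times the average, over all subsets, of bilinear forms in
independent vectors. Jensen's inequality moves the average outside the exponential, and the factor 4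
turns s² into 16 s². The sign of s is free, which the lower tail needs. -/
theorem lintegral_exp_offDiag_le [DecidableEq ι] {ξ : Ω → ι → ℝ}
    (hξ : Measurable ξ) (hind : iIndepFun (fun i ω => ξ ω i) P) {g : ℝ} (hg : 0 ≤ g)
    (hsub : SubGaussianMoments ξ g P) {M : Matrix ι ι ℝ} (hM : M.PosSemidef) {L : ℝ} (hL0 : 0 < L)
    (hL : ∀ x, x ⬝ᵥ M *ᵥ x ≤ L * (x ⬝ᵥ x)) {s : ℝ}
    (hs : 16 * s ^ 2 * g ^ 2 * L ^ 2 ≤ 1 / 2) :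
    ∫⁻ ω, ENNReal.ofReal (Real.exp (s * (ξ ω ⬝ᵥ M *ᵥ ξ ω - ∑ i, M i i * ξ ω i ^ 2))) ∂P
      ≤ ENNReal.ofReal (Real.exp (16 * s ^ 2 * g ^ 2 * L * M.trace)) := by
  have := hind.isProbabilityMeasure
  set N : ℝ := (Fintype.card (ι → Bool) : ℝ)
  have hN : 0 < N := by simp only [N]; exact_mod_cast Fintype.card_pos
  set T : (ι → Bool) → Ω → ℝ := fun σ ω =>
    ((fun i => if σ i then (1 : ℝ) else 0) * ξ ω) ⬝ᵥ
        M *ᵥ ((fun j => if σ j then (0 : ℝ) else 1) * ξ ω)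
  have hT : ∀ σ, ∫⁻ ω, ENNReal.ofReal (Real.exp ((4 * s) * T σ ω)) ∂P
      ≤ ENNReal.ofReal (Real.exp (16 * s ^ 2 * g ^ 2 * L * M.trace)) := fun σ => by
    have ha : ∀ i, (if σ i then (1 : ℝ) else 0) ^ 2 ≤ 1 := fun i => by cases σ i <;> simp
    have hb : ∀ i, (if σ i then (0 : ℝ) else 1) ^ 2 ≤ 1 := fun i => by cases σ i <;> simp
    refine (lintegral_exp_bilinear_le (by fun_prop) (by fun_prop) (indepFun_mask hξ hind σ) hg
      (hsub.mul_left hg ha) (hsub.mul_left hg hb) hM hL0 hL (by linarith)).trans (le_of_eq ?_)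
    congr 2; ring
  have hTm : ∀ σ, Measurable (T σ) := fun σ => by
    have : Measurable fun q : (ι → ℝ) × (ι → ℝ) => q.1 ⬝ᵥ M *ᵥ q.2 := by
      simp only [dotProduct, Matrix.mulVec]; fun_prop
    exact this.comp (by fun_prop : Measurable fun ω =>
      (((fun i => if σ i then (1 : ℝ) else 0) * ξ ω), (fun j => if σ j then (0 : ℝ) else 1) * ξ ω))
  have hpt : ∀ ω, ENNReal.ofReal
      (Real.exp (s * (ξ ω ⬝ᵥ M *ᵥ ξ ω - ∑ i, M i i * ξ ω i ^ 2)))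
      ≤ ENNReal.ofReal N⁻¹ * ∑ σ, ENNReal.ofReal (Real.exp ((4 * s) * T σ ω)) := by
    intro ω
    rw [← ENNReal.ofReal_sum_of_nonneg (fun _ _ => (Real.exp_pos _).le),
      ← ENNReal.ofReal_mul (by positivity)]
    apply ENNReal.ofReal_le_ofReal
    have hJ := convexOn_exp.map_sum_le (t := Finset.univ) (w := fun _ : ι → Bool => N⁻¹)
      (p := fun σ => (4 * s) * T σ ω) (fun _ _ => by positivity)
      (by simp [N]) (fun _ _ => Set.mem_univ _)
    simp only [smul_eq_mul, ← Finset.mul_sum] at hJ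
    refine le_trans (le_of_eq ?_) hJ
    rw [show ∑ σ, T σ ω = _ from sum_decoupled M (ξ ω)]
    congr 1
    change _ = N⁻¹ * (4 * s * (N / 4 * _))
    field_simp
  calc _ ≤ ∫⁻ ω, ENNReal.ofReal N⁻¹ * ∑ σ, ENNReal.ofReal (Real.exp ((4 * s) * T σ ω)) ∂P :=
        lintegral_mono hpt
    _ = ENNReal.ofReal N⁻¹ * ∑ σ, ∫⁻ ω, ENNReal.ofReal (Real.exp ((4 * s) * T σ ω)) ∂P := by
        rw [lintegral_const_mul _ (Finset.measurable_sum _ fun σ _ => by have := hTm σ; fun_prop),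
          lintegral_finsetSum _ fun σ _ => by have := hTm σ; fun_prop]
    _ ≤ ENNReal.ofReal N⁻¹ * ∑ σ : ι → Bool,
          ENNReal.ofReal (Real.exp (16 * s ^ 2 * g ^ 2 * L * M.trace)) := by
        gcongr with σ; exact hT σ
    _ = _ := by
        rw [Finset.sum_const, nsmul_eq_mul, ← mul_assoc, ← ENNReal.ofReal_natCast,
          ← ENNReal.ofReal_mul (by positivity)]
        have : N⁻¹ * ((Finset.univ : Finset (ι → Bool)).card : ℝ) = 1 := by
          rw [Finset.card_univ]; exact inv_mul_cancel₀ hN.ne'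
        rw [this, ENNReal.ofReal_one, one_mul]

end HansonWright

/-! ### Upper and lower tails of quadratic forms. -/

section Tails

variable {Ω : Type*} [MeasurableSpace Ω] {ι : Type*} [Fintype ι] {P : Measure Ω}

theorem integrable_pow_of_hasSubgaussianMGF {y : Ω → ℝ} {c : NNReal}
    (hy : HasSubgaussianMGF y c P) [IsFiniteMeasure P] (k : ℕ) :
    Integrable (fun ω => y ω ^ k) P := by
  have := (hy.memLp (k : NNReal)).integrable_norm_pow'
  refine this.mono' (by have := hy.aestronglyMeasurable; fun_prop) (ae_of_all _ fun ω => ?_)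
  simp

theorem integral_pow_four_le [IsProbabilityMeasure P] {y : Ω → ℝ} {c : NNReal} (hc : 0 < c)
    (hy : HasSubgaussianMGF y c P) : ∫ ω, y ω ^ 4 ∂P ≤ 96 * (c : ℝ) ^ 2 := by
  -- This scale makes both exponential moments at most e^{1/2} ≤ 2; then (ty)⁴/24 ≤ e^{ty} + e^{-ty}
  -- gives 24 · 4 = 96.
  set t : ℝ := (√c)⁻¹
  have hc' : (0 : ℝ) < c := hc
  have ht2 : t ^ 2 = (c : ℝ)⁻¹ := by simp [t, inv_pow, Real.sq_sqrt hc'.le]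
  have hpt : ∀ ω, t ^ 4 / 24 * y ω ^ 4 ≤ Real.exp (t * y ω) + Real.exp ((-t) * y ω) := by
    intro ω
    have h1 := Real.pow_div_factorial_le_exp |t * y ω| (abs_nonneg _) 4
    have h2 : |t * y ω| ^ 4 = t ^ 4 * y ω ^ 4 := by
      rw [(by decide : Even 4).pow_abs, mul_pow]
    rw [h2] at h1
    have h3 : Real.exp |t * y ω| ≤ Real.exp (t * y ω) + Real.exp ((-t) * y ω) := by
      rcases abs_choice (t * y ω) with h | h <;> rw [h]
      · linarith [Real.exp_pos ((-t) * y ω)]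
      · rw [← neg_mul]; linarith [Real.exp_pos (t * y ω)]
    rw [show ((Nat.factorial 4 : ℕ) : ℝ) = 24 by norm_num [Nat.factorial]] at h1
    linarith
  have hint := integral_mono ((integrable_pow_of_hasSubgaussianMGF hy 4).const_mul (t ^ 4 / 24))
    ((hy.integrable_exp_mul t).add (hy.integrable_exp_mul (-t))) hpt
  simp only [Pi.add_apply] at hint
  rw [integral_const_mul, integral_add (hy.integrable_exp_mul t) (hy.integrable_exp_mul (-t))] at hint
  have e1 := hy.mgf_le t
  have e2 := hy.mgf_le (-t)
  simp only [mgf] at e1 e2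
  rw [neg_sq] at e2
  rw [ht2, mul_inv_cancel₀ hc'.ne'] at e1 e2
  have he : Real.exp (1 / 2) ≤ 2 := by
    have h1 : Real.exp (1 / 2) ^ 2 = Real.exp 1 := by rw [← Real.exp_nat_mul]; norm_num
    nlinarith [Real.exp_one_lt_d9, Real.exp_pos (1 / 2)]
  have ht4 : t ^ 4 = ((c : ℝ) ^ 2)⁻¹ := by
    rw [show t ^ 4 = (t ^ 2) ^ 2 by ring, ht2, inv_pow]
  rw [ht4] at hint
  have h5 : ((c : ℝ) ^ 2)⁻¹ / 24 * ∫ ω, y ω ^ 4 ∂P ≤ 4 := by linarith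
  have h6 : ∫ ω, y ω ^ 4 ∂P = (24 * (c : ℝ) ^ 2) * (((c : ℝ) ^ 2)⁻¹ / 24 * ∫ ω, y ω ^ 4 ∂P) := by
    field_simp
  rw [h6]
  nlinarith [sq_nonneg (c : ℝ)]

/-- (1 + x + x²/2)(1 - x + x²/2) = 1 + x⁴/4 ≥ 1, and the first factor is at most e^x. -/
theorem exp_neg_le_quadratic {x : ℝ} (hx : 0 ≤ x) : Real.exp (-x) ≤ 1 - x + x ^ 2 / 2 := by
  have h1 := Real.quadratic_le_exp_of_nonneg hx
  rw [Real.exp_neg, inv_le_iff_one_le_mul₀ (Real.exp_pos x)]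
  have h2 : 0 < 1 - x + x ^ 2 / 2 := by nlinarith [sq_nonneg (x - 1)]
  nlinarith [mul_le_mul_of_nonneg_left h1 h2.le, sq_nonneg (x ^ 2)]

/-- A square has no negative part, so a second-order expansion of its negative exponential holds for
every a ≥ 0 and only needs the fourth moment; 48 is half of 96. -/
theorem lintegral_exp_neg_sq_le [IsProbabilityMeasure P] {y : Ω → ℝ} {c : NNReal} (hc : 0 < c)
    (hy : HasSubgaussianMGF y c P) (hvar : ∫ ω, y ω ^ 2 ∂P = 1) {a : ℝ} (ha : 0 ≤ a) :
    ∫⁻ ω, ENNReal.ofReal (Real.exp (-(a * y ω ^ 2))) ∂P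
      ≤ ENNReal.ofReal (Real.exp (-a + 48 * (c : ℝ) ^ 2 * a ^ 2)) := by
  have i2 := integrable_pow_of_hasSubgaussianMGF hy 2
  have i4 := integrable_pow_of_hasSubgaussianMGF hy 4
  have hint1 : Integrable (fun ω => 1 - a * y ω ^ 2) P := (integrable_const 1).sub (i2.const_mul a)
  have hint : Integrable (fun ω => 1 - a * y ω ^ 2 + a ^ 2 / 2 * y ω ^ 4) P :=
    (hint1.add (i4.const_mul _))
  have hpt : ∀ ω, Real.exp (-(a * y ω ^ 2)) ≤ 1 - a * y ω ^ 2 + a ^ 2 / 2 * y ω ^ 4 := fun ω =>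
    (exp_neg_le_quadratic (by positivity)).trans (le_of_eq (by ring))
  calc _ ≤ ∫⁻ ω, ENNReal.ofReal (1 - a * y ω ^ 2 + a ^ 2 / 2 * y ω ^ 4) ∂P :=
        lintegral_mono fun ω => ENNReal.ofReal_le_ofReal (hpt ω)
    _ = ENNReal.ofReal (∫ ω, (1 - a * y ω ^ 2 + a ^ 2 / 2 * y ω ^ 4) ∂P) :=
        (ofReal_integral_eq_lintegral_ofReal hint
          (ae_of_all _ fun ω => (Real.exp_pos _).le.trans (hpt ω))).symm
    _ ≤ _ := by
        apply ENNReal.ofReal_le_ofReal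
        rw [integral_add hint1 (i4.const_mul _),
          integral_sub (integrable_const 1) (i2.const_mul a), integral_const_mul,
          integral_const_mul, hvar]
        have h4 := integral_pow_four_le hc hy
        have h5 := Real.add_one_le_exp (-a + 48 * (c : ℝ) ^ 2 * a ^ 2)
        have h6 := mul_le_mul_of_nonneg_left h4 (show 0 ≤ a ^ 2 / 2 by positivity)
        simp only [integral_const, probReal_univ, smul_eq_mul, mul_one]
        linarith

theorem lintegral_exp_neg_diag_le {ξ : Ω → ι → ℝ} (hξ : Measurable ξ)
    (hind : iIndepFun (fun i ω => ξ ω i) P) {c : NNReal} (hc : 0 < c)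
    (hsub : ∀ i, HasSubgaussianMGF (fun ω => ξ ω i) c P) (hvar : ∀ i, ∫ ω, ξ ω i ^ 2 ∂P = 1)
    {d : ι → ℝ} {L : ℝ} (hd0 : ∀ i, 0 ≤ d i) (hdL : ∀ i, d i ≤ L) {s : ℝ} (hs : 0 ≤ s) :
    ∫⁻ ω, ENNReal.ofReal (Real.exp (-s * ∑ i, d i * ξ ω i ^ 2)) ∂P
      ≤ ENNReal.ofReal (Real.exp ((-s + 48 * s ^ 2 * (c : ℝ) ^ 2 * L) * ∑ i, d i)) := by
  have := hind.isProbabilityMeasure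
  have h1 : ∀ ω, ENNReal.ofReal (Real.exp (-s * ∑ i, d i * ξ ω i ^ 2))
      = ∏ i, ENNReal.ofReal (Real.exp (-((s * d i) * ξ ω i ^ 2))) := by
    intro ω
    rw [← ENNReal.ofReal_prod_of_nonneg fun _ _ => (Real.exp_pos _).le, ← Real.exp_sum,
      Finset.mul_sum]
    congr 2
    exact Finset.sum_congr rfl fun i _ => by ring
  simp_rw [h1]
  rw [lintegral_prod_eq_prod_lintegral_of_indepFun Finset.univ
    (fun i ω => ENNReal.ofReal (Real.exp (-((s * d i) * ξ ω i ^ 2))))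
    (hind.comp (fun i t => ENNReal.ofReal (Real.exp (-((s * d i) * t ^ 2)))) fun i => by fun_prop)
    (fun i => by fun_prop), Finset.mul_sum, Real.exp_sum,
    ENNReal.ofReal_prod_of_nonneg fun _ _ => (Real.exp_pos _).le]
  refine Finset.prod_le_prod' fun i _ => ?_
  refine (lintegral_exp_neg_sq_le hc (hsub i) (hvar i) (mul_nonneg hs (hd0 i))).trans ?_
  apply ENNReal.ofReal_le_ofReal (Real.exp_le_exp.2 _)
  have := mul_le_mul_of_nonneg_left (hdL i)
    (show 0 ≤ 48 * s ^ 2 * (c : ℝ) ^ 2 * d i by have := hd0 i; positivity)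
  nlinarith

theorem measurable_quadratic {ξ : Ω → ι → ℝ} (hξ : Measurable ξ) (M : Matrix ι ι ℝ) :
    Measurable fun ω => ξ ω ⬝ᵥ M *ᵥ ξ ω := by
  simp only [dotProduct, Matrix.mulVec]; fun_prop

theorem quadratic_upper_tail [DecidableEq ι] [IsProbabilityMeasure P] {x : Ω → ι → ℝ}
    (hx : Measurable x) {g : ℝ} (hg : 0 < g) (hsub : SubGaussianMoments x g P)
    {M : Matrix ι ι ℝ} (hM : M.PosSemidef) {L : ℝ} (hL0 : 0 < L)
    (hL : ∀ y, y ⬝ᵥ M *ᵥ y ≤ L * (y ⬝ᵥ y)) (r : ℝ) :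
    P {ω | 2 * g * M.trace + 4 * g * L * r < x ω ⬝ᵥ M *ᵥ x ω} ≤ ENNReal.ofReal (Real.exp (-r)) := by
  -- The largest s that the exponential bound admits.
  have h := lintegral_exp_quadratic_le hx hsub hM hL (s := 1 / (4 * g * L)) (by positivity) hg.le
    (le_of_eq (by field_simp))
  have h2 := measure_lt_le_of_lintegral_exp_le ((measurable_quadratic hx M).const_mul _)
    (t := 1 / (4 * g * L) * (2 * g * M.trace + 4 * g * L * r)) h
  refine le_trans (measure_mono fun ω hω => ?_) (h2.trans (le_of_eq ?_))
  · simp only [Set.mem_ofPred_eq] at hω ⊢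
    exact mul_lt_mul_of_pos_left hω (by positivity)
  · congr 2
    field_simp
    ring

/-- Lower tail of a positive semidefinite quadratic form in independent sub-Gaussian variables. -/
theorem quadratic_lower_tail [DecidableEq ι] {ξ : Ω → ι → ℝ} (hξ : Measurable ξ)
    (hind : iIndepFun (fun i ω => ξ ω i) P) {c : NNReal} (hc : 1 ≤ c)
    (hsub : ∀ i, HasSubgaussianMGF (fun ω => ξ ω i) c P) (hvar : ∀ i, ∫ ω, ξ ω i ^ 2 ∂P = 1)
    {M : Matrix ι ι ℝ} (hM : M.PosSemidef) {L : ℝ} (hL0 : 0 < L)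
    (hL : ∀ y, y ⬝ᵥ M *ᵥ y ≤ L * (y ⬝ᵥ y)) :
    P {ω | ξ ω ⬝ᵥ M *ᵥ ξ ω < M.trace / 2} ≤
      2 * ENNReal.ofReal (Real.exp (-(M.trace / (3072 * (c : ℝ) ^ 2 * L)))) := by
  have := hind.isProbabilityMeasure
  have hc1 : (1 : ℝ) ≤ c := by exact_mod_cast hc
  have hc0 : (0 : ℝ) < c := by linarith
  have htr : 0 ≤ M.trace := hM.trace_nonneg
  have hd0 : ∀ i, 0 ≤ M i i := fun i => by
    rw [diag_eq_dotProduct M]; exact posSemidef_dotProduct_nonneg hM _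
  have hdL : ∀ i, M i i ≤ L := fun i => by
    rw [diag_eq_dotProduct M]; refine (hL _).trans (le_of_eq ?_); simp
  have htr' : ∑ i, M i i = M.trace := rfl
  have hDm : Measurable fun ω => ∑ i, M i i * ξ ω i ^ 2 := by fun_prop
  -- A form below tr M/2 has diagonal part below 3/4 tr M or off-diagonal part below -1/4 tr M. Here
  -- the exponent -s + 48 s²c²L equals -7s/8, and 7/8 - 3/4 = 1/8 leaves tr M/(8 · 384 c²L), the
  -- 3072 of the statement. The off-diagonal choice of s gives an exponent three times as large.
  have hD := lintegral_exp_neg_diag_le hξ hind (by exact_mod_cast hc0) hsub hvar hd0 hdL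
    (s := 1 / (384 * (c : ℝ) ^ 2 * L)) (by positivity)
  have hO := lintegral_exp_offDiag_le hξ hind hc0.le (subGaussianMoments_of_iIndepFun hind hsub) hM
    hL0 hL (s := -(1 / (128 * (c : ℝ) ^ 2 * L))) (by
      have h1 : 16 * (-(1 / (128 * (c : ℝ) ^ 2 * L))) ^ 2 * (c : ℝ) ^ 2 * L ^ 2
          = 1 / (1024 * (c : ℝ) ^ 2) := by field_simp; norm_num
      rw [h1, div_le_iff₀ (by positivity)]
      nlinarith)
  have tD := measure_lt_le_of_lintegral_exp_le (hDm.const_mul _)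
    (t := -(1 / (384 * (c : ℝ) ^ 2 * L)) * (3 / 4 * M.trace)) hD
  have tO := measure_lt_le_of_lintegral_exp_le (((measurable_quadratic hξ M).sub hDm).const_mul _)
    (t := -(1 / (128 * (c : ℝ) ^ 2 * L)) * (-(1 / 4) * M.trace)) hO
  calc P {ω | ξ ω ⬝ᵥ M *ᵥ ξ ω < M.trace / 2}
      ≤ P ({ω | -(1 / (384 * (c : ℝ) ^ 2 * L)) * (3 / 4 * M.trace) <
            -(1 / (384 * (c : ℝ) ^ 2 * L)) * ∑ i, M i i * ξ ω i ^ 2} ∪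
          {ω | -(1 / (128 * (c : ℝ) ^ 2 * L)) * (-(1 / 4) * M.trace) <
            -(1 / (128 * (c : ℝ) ^ 2 * L)) * (ξ ω ⬝ᵥ M *ᵥ ξ ω - ∑ i, M i i * ξ ω i ^ 2)}) := by
        refine measure_mono fun ω hω => ?_
        simp only [Set.mem_union, Set.mem_ofPred_eq] at hω ⊢
        by_contra hcon
        push Not at hcon
        obtain ⟨h1, h2⟩ := hcon
        rw [neg_mul, neg_mul, neg_le_neg_iff, mul_le_mul_iff_right₀ (by positivity)] at h1 h2
        linarith
    _ ≤ _ := measure_union_le _ _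
    _ ≤ _ := add_le_add tD tO
    _ ≤ _ := by
        rw [two_mul]
        refine add_le_add (ENNReal.ofReal_le_ofReal (Real.exp_le_exp.2 ?_))
          (ENNReal.ofReal_le_ofReal (Real.exp_le_exp.2 ?_))
        · rw [htr']
          apply le_of_eq
          field_simp
          ring
        · have h1 : 16 * (-(1 / (128 * (c : ℝ) ^ 2 * L))) ^ 2 * (c : ℝ) ^ 2 * L * M.trace
              - -(1 / (128 * (c : ℝ) ^ 2 * L)) * (-(1 / 4) * M.trace)
              = -(3 * (M.trace / (3072 * (c : ℝ) ^ 2 * L))) := by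
            field_simp
            ring
          have h2 : 0 ≤ M.trace / (3072 * (c : ℝ) ^ 2 * L) := by positivity
          rw [h1]; linarith

end Tails

/-! ### Nets of the sphere and conditioning of random matrices. -/

section Nets

open Metric Module in
-- Volume comparison: the balls of radius δ/2 around the points are disjoint and lie in the ball of
-- radius 1 + δ/2.
theorem card_le_of_separated_of_norm_le_one {E : Type*} [NormedAddCommGroup E] [NormedSpace ℝ E]
    [FiniteDimensional ℝ E] {δ : ℝ} (hδ : 0 < δ) (s : Finset E) (hs : ∀ c ∈ s, ‖c‖ ≤ 1)
    (h : ∀ c ∈ s, ∀ d ∈ s, c ≠ d → δ ≤ ‖c - d‖) :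
    (s.card : ℝ) ≤ (1 + 2 / δ) ^ finrank ℝ E := by
  borelize E
  let μ : Measure E := Measure.addHaar
  set r : ℝ := δ / 2
  have hr : 0 < r := by positivity
  set ρ : ℝ := 1 + δ / 2
  have hρ : 0 < ρ := by positivity
  have hdisj : Set.Pairwise (s : Set E) (Function.onFun Disjoint fun c => ball (c : E) r) := by
    rintro c hc d hd hcd
    apply ball_disjoint_ball
    rw [dist_eq_norm]
    have := h c hc d hd hcd
    simp only [r]; linarith
  have hsub : (⋃ c ∈ s, ball (c : E) r) ⊆ ball (0 : E) ρ := by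
    refine Set.iUnion₂_subset fun x hx => ball_subset_ball' ?_
    rw [dist_zero_right]
    have := hs x hx
    simp only [r, ρ]; linarith
  have I : (s.card : ENNReal) * ENNReal.ofReal (r ^ finrank ℝ E) * μ (ball 0 1) ≤
      ENNReal.ofReal (ρ ^ finrank ℝ E) * μ (ball 0 1) := by
    calc _ = μ (⋃ c ∈ s, ball (c : E) r) := by
          rw [measure_biUnion_finset hdisj fun c _ => measurableSet_ball]
          simp only [μ.addHaar_ball_of_pos _ hr, Finset.sum_const, nsmul_eq_mul, mul_assoc]
      _ ≤ μ (ball (0 : E) ρ) := measure_mono hsub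
      _ = _ := by simp only [μ.addHaar_ball_of_pos _ hρ]
  have J : (s.card : ENNReal) * ENNReal.ofReal (r ^ finrank ℝ E) ≤ ENNReal.ofReal (ρ ^ finrank ℝ E) :=
    (ENNReal.mul_le_mul_iff_left (measure_ball_pos _ _ zero_lt_one).ne' measure_ball_lt_top.ne).1 I
  have K := ENNReal.toReal_le_of_le_ofReal (pow_nonneg hρ.le _) J
  rw [ENNReal.toReal_mul, ENNReal.toReal_natCast, ENNReal.toReal_ofReal (pow_nonneg hr.le _)] at K
  rw [show 1 + 2 / δ = ρ / r by simp only [ρ, r]; field_simp; ring, div_pow,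
    le_div_iff₀ (pow_pos hr _)]
  exact K

/-- A separated subset of maximal cardinality is a net, since any uncovered unit vector could be
added to it; the volume bound makes the maximum exist. -/
theorem exists_sphere_net {E : Type*} [NormedAddCommGroup E] [NormedSpace ℝ E]
    [FiniteDimensional ℝ E] {δ : ℝ} (hδ : 0 < δ) :
    ∃ s : Finset E, (s.card : ℝ) ≤ (1 + 2 / δ) ^ Module.finrank ℝ E ∧ (∀ c ∈ s, ‖c‖ = 1) ∧
      ∀ u : E, ‖u‖ = 1 → ∃ v ∈ s, ‖u - v‖ ≤ δ := by
  classical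
  set S : Set ℕ := {m | ∃ s : Finset E, s.card = m ∧ (∀ c ∈ s, ‖c‖ = 1) ∧
    ∀ c ∈ s, ∀ d ∈ s, c ≠ d → δ ≤ ‖c - d‖}
  have hbdd : BddAbove S := by
    refine ⟨⌈(1 + 2 / δ) ^ Module.finrank ℝ E⌉₊, ?_⟩
    rintro m ⟨s, rfl, h1, h2⟩
    exact_mod_cast (card_le_of_separated_of_norm_le_one hδ s (fun c hc => (h1 c hc).le) h2).trans
      (Nat.le_ceil _)
  have hne : S.Nonempty := ⟨0, ∅, by simp⟩
  obtain ⟨s, hcard, h1, h2⟩ := Nat.sSup_mem hne hbdd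
  refine ⟨s, card_le_of_separated_of_norm_le_one hδ s (fun c hc => (h1 c hc).le) h2, h1, ?_⟩
  intro u hu
  by_contra hcon
  push Not at hcon
  have hus : u ∉ s := fun h => by
    have := hcon u h
    simp at this
    linarith
  have hmem : s.card + 1 ∈ S := by
    refine ⟨insert u s, Finset.card_insert_of_notMem hus, ?_, ?_⟩
    · intro c hc
      rcases Finset.mem_insert.1 hc with rfl | hc
      exacts [hu, h1 c hc]
    · intro c hc d hd hcd
      rcases Finset.mem_insert.1 hc with hcu | hcs <;> rcases Finset.mem_insert.1 hd with hdu | hds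
      · exact absurd (hcu.trans hdu.symm) hcd
      · rw [hcu]; exact (hcon d hds).le
      · rw [hdu, norm_sub_rev]; exact (hcon c hcs).le
      · exact h2 c hcs d hds hcd
  have := le_csSup hbdd hmem
  omega

/-- Two-sided bounds for a linear map on a net of the unit sphere extend to the whole sphere. -/
theorem norm_bounds_of_net {E F : Type*} [NormedAddCommGroup E] [NormedSpace ℝ E]
    [NormedAddCommGroup F] [NormedSpace ℝ F] (f : E →L[ℝ] F) {s : Set E} {δ a b : ℝ}
    (hδ : δ ≤ 1 / 2) (hδ0 : 0 ≤ δ)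
    (hb0 : 0 ≤ b) (hab : 4 * b * δ ≤ a) (hnet : ∀ u : E, ‖u‖ = 1 → ∃ v ∈ s, ‖u - v‖ ≤ δ)
    (ha : ∀ v ∈ s, a ≤ ‖f v‖) (hb : ∀ v ∈ s, ‖f v‖ ≤ b) (u : E) :
    a / 2 * ‖u‖ ≤ ‖f u‖ ∧ ‖f u‖ ≤ 2 * b * ‖u‖ := by
  -- Self-bounding: approximating by the net gives ‖f‖ ≤ b + ‖f‖δ, and δ ≤ 1/2 absorbs the last
  -- term. The lower bound then loses at most 2bδ ≤ a/2.
  have hf : ‖f‖ ≤ 2 * b := by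
    have : ‖f‖ ≤ b + ‖f‖ * δ := by
      refine f.opNorm_le_of_unit_norm (by positivity) fun x hx => ?_
      obtain ⟨v, hv, hxv⟩ := hnet x hx
      have h1 : f x = f v + f (x - v) := by rw [← map_add]; congr 1; abel
      rw [h1]
      refine (norm_add_le _ _).trans (add_le_add (hb v hv) ?_)
      exact (f.le_opNorm _).trans (mul_le_mul_of_nonneg_left hxv (norm_nonneg _))
    nlinarith [norm_nonneg f]
  refine ⟨?_, (f.le_opNorm u).trans (mul_le_mul_of_nonneg_right hf (norm_nonneg _))⟩
  by_cases hu : u = 0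
  · simp [hu]
  have hu0 : 0 < ‖u‖ := norm_pos_iff.2 hu
  set x := ‖u‖⁻¹ • u
  have hx : ‖x‖ = 1 := by simp [x, norm_smul, inv_mul_cancel₀ hu0.ne']
  obtain ⟨v, hv, hxv⟩ := hnet x hx
  have h1 : f v = f x - f (x - v) := by rw [← map_sub]; congr 1; abel
  have h2 : ‖f v‖ ≤ ‖f x‖ + ‖f‖ * δ := by
    rw [h1]
    exact (norm_sub_le _ _).trans (add_le_add_right ((f.le_opNorm _).trans
      (mul_le_mul_of_nonneg_left hxv (norm_nonneg _))) _)
  have h3 : ‖f x‖ = ‖u‖⁻¹ * ‖f u‖ := by simp [x, norm_smul]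
  have h4 : a / 2 ≤ ‖u‖⁻¹ * ‖f u‖ := by
    rw [← h3]
    have := ha v hv
    nlinarith [mul_le_mul_of_nonneg_right hf hδ0]
  rw [mul_comm]
  calc ‖u‖ * (a / 2) ≤ ‖u‖ * (‖u‖⁻¹ * ‖f u‖) := by gcongr
    _ = ‖f u‖ := by rw [mul_inv_cancel_left₀ hu0.ne']

theorem norm_toLp_sq {ι : Type*} [Fintype ι] (v : ι → ℝ) : ‖WithLp.toLp 2 v‖ ^ 2 = v ⬝ᵥ v := by
  rw [EuclideanSpace.norm_sq_eq]
  simp [dotProduct, pow_two]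

/-- A sphere net that controls all matrices with `d` columns. -/
theorem exists_matrix_net (d : ℕ) {c : ℝ} (hc : 1 ≤ c) :
    ∃ s : Finset (Fin d → ℝ), (s.card : ℝ) ≤ (33 * c) ^ d ∧ (∀ v ∈ s, v ⬝ᵥ v = 1) ∧
      ∀ {κ : Type} [Fintype κ] (G : Matrix κ (Fin d) ℝ) (τ : ℝ), 0 ≤ τ →
        (∀ v ∈ s, τ / 2 ≤ (G *ᵥ v) ⬝ᵥ (G *ᵥ v) ∧ (G *ᵥ v) ⬝ᵥ (G *ᵥ v) ≤ 4 * c * τ) →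
        ∀ u, τ / 8 * (u ⬝ᵥ u) ≤ (G *ᵥ u) ⬝ᵥ (G *ᵥ u) ∧
          (G *ᵥ u) ⬝ᵥ (G *ᵥ u) ≤ 16 * c * τ * (u ⬝ᵥ u) := by
  classical
  have hc0 : 0 < c := by linarith
  -- With this mesh 1 + 2/δ = 1 + 32c ≤ 33c, and 4bδ ≤ a holds for a² = τ/2, b² = 4cτ because (4bδ)²
  -- = τ/(4c). The net is chosen before `G`, so that a union bound over it makes sense for a random
  -- matrix.
  obtain ⟨s, hcard, h1, hnet⟩ := exists_sphere_net (E := EuclideanSpace ℝ (Fin d))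
    (δ := 1 / (16 * c)) (by positivity)
  refine ⟨s.image WithLp.ofLp, ?_, ?_, ?_⟩
  · refine (Nat.cast_le.2 Finset.card_image_le).trans (hcard.trans ?_)
    rw [finrank_euclideanSpace_fin]
    gcongr
    field_simp
    linarith
  · intro v hv
    obtain ⟨w, hw, rfl⟩ := Finset.mem_image.1 hv
    rw [← norm_toLp_sq]
    simp [h1 w hw]
  · intro κ _ G τ hτ hG u
    set f : EuclideanSpace ℝ (Fin d) →L[ℝ] EuclideanSpace ℝ κ :=
      LinearMap.toContinuousLinearMap (Matrix.toEuclideanLin G)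
    have hf : ∀ v : EuclideanSpace ℝ (Fin d), ‖f v‖ ^ 2 = (G *ᵥ v.ofLp) ⬝ᵥ (G *ᵥ v.ofLp) := by
      intro v
      rw [← norm_toLp_sq]
      rfl
    have hb := norm_bounds_of_net f (s := s) (δ := 1 / (16 * c)) (a := √(τ / 2)) (b := √(4 * c * τ))
      (by rw [div_le_div_iff₀ (by positivity) (by norm_num)]; linarith) (by positivity)
      (Real.sqrt_nonneg _) ?_ hnet ?_ ?_ (WithLp.toLp 2 u)
    · obtain ⟨hlo, hhi⟩ := hb
      have e1 : ‖f (WithLp.toLp 2 u)‖ ^ 2 = (G *ᵥ u) ⬝ᵥ (G *ᵥ u) := hf _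
      have e2 := norm_toLp_sq u
      rw [← e1, ← e2]
      have s1 : √(τ / 2) ^ 2 = τ / 2 := Real.sq_sqrt (by positivity)
      have s2 : √(4 * c * τ) ^ 2 = 4 * c * τ := Real.sq_sqrt (by positivity)
      constructor
      · calc τ / 8 * ‖WithLp.toLp 2 u‖ ^ 2 = (√(τ / 2) / 2 * ‖WithLp.toLp 2 u‖) ^ 2 := by
              rw [mul_pow, div_pow, s1]; ring
          _ ≤ _ := by gcongr
      · calc _ ≤ (2 * √(4 * c * τ) * ‖WithLp.toLp 2 u‖) ^ 2 := by gcongr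
          _ = _ := by rw [mul_pow, mul_pow, s2]; ring
    · apply Real.le_sqrt_of_sq_le
      rw [mul_pow, mul_pow, Real.sq_sqrt (by positivity), div_pow, mul_pow]
      have : (4 : ℝ) ^ 2 * (4 * c * τ) * (1 ^ 2 / (16 ^ 2 * c ^ 2)) = τ / (4 * c) := by
        field_simp; ring
      rw [this]
      gcongr
      linarith
    · intro v hv
      rw [← Real.sqrt_sq (norm_nonneg (f v)), hf]
      exact Real.sqrt_le_sqrt (hG _ (Finset.mem_image_of_mem _ hv)).1
    · intro v hv
      rw [← Real.sqrt_sq (norm_nonneg (f v)), hf]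
      exact Real.sqrt_le_sqrt (hG _ (Finset.mem_image_of_mem _ hv)).2

/-- A random matrix `G` such that each `|G v|²` is a quadratic form in independent sub-Gaussian
variables is well conditioned. -/
theorem measure_not_wellConditioned_le {Ω : Type*} [MeasurableSpace Ω] {P : Measure Ω}
    {ι κ : Type} [Fintype ι] [DecidableEq ι] [Fintype κ] {d : ℕ} (G : Ω → Matrix κ (Fin d) ℝ)
    {c : NNReal} (hc : 1 ≤ c) {M : Matrix ι ι ℝ} (hM : M.PosSemidef) {L : ℝ} (hL0 : 0 < L)
    (hL : ∀ y, y ⬝ᵥ M *ᵥ y ≤ L * (y ⬝ᵥ y)) (ξ : (Fin d → ℝ) → Ω → ι → ℝ)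
    (hG : ∀ v ω, (G ω *ᵥ v) ⬝ᵥ (G ω *ᵥ v) = ξ v ω ⬝ᵥ M *ᵥ ξ v ω)
    (hξ : ∀ v, Measurable (ξ v)) (hind : ∀ v, iIndepFun (fun i ω => ξ v ω i) P)
    (hsub : ∀ v, v ⬝ᵥ v = 1 → ∀ i, HasSubgaussianMGF (fun ω => ξ v ω i) c P)
    (hvar : ∀ v, v ⬝ᵥ v = 1 → ∀ i, ∫ ω, ξ v ω i ^ 2 ∂P = 1) :
    P {ω | ¬ ∀ u, M.trace / 8 * (u ⬝ᵥ u) ≤ (G ω *ᵥ u) ⬝ᵥ (G ω *ᵥ u) ∧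
        (G ω *ᵥ u) ⬝ᵥ (G ω *ᵥ u) ≤ 16 * c * M.trace * (u ⬝ᵥ u)} ≤
      ENNReal.ofReal (3 * Real.exp (d * Real.log (33 * c) - M.trace / (3072 * (c : ℝ) ^ 2 * L))) := by
  have hc1 : (1 : ℝ) ≤ c := by exact_mod_cast hc
  have hc0 : (0 : ℝ) < c := by linarith
  have htr : 0 ≤ M.trace := hM.trace_nonneg
  obtain ⟨s, hcard, hs1, hnet⟩ := exists_matrix_net d hc1
  set q := ENNReal.ofReal (Real.exp (-(M.trace / (3072 * (c : ℝ) ^ 2 * L))))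
  calc _ ≤ P (⋃ v ∈ s, ({ω | ξ v ω ⬝ᵥ M *ᵥ ξ v ω < M.trace / 2} ∪
          {ω | 4 * c * M.trace < ξ v ω ⬝ᵥ M *ᵥ ξ v ω})) := by
        refine measure_mono fun ω hω => ?_
        by_contra hcon
        simp only [Set.mem_iUnion, Set.mem_union, Set.mem_ofPred_eq, not_exists, not_or, not_lt]
          at hcon
        refine hω (hnet (G ω) M.trace htr fun v hv => ?_)
        rw [hG]
        exact hcon v hv
    _ ≤ ∑ v ∈ s, P ({ω | ξ v ω ⬝ᵥ M *ᵥ ξ v ω < M.trace / 2} ∪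
          {ω | 4 * c * M.trace < ξ v ω ⬝ᵥ M *ᵥ ξ v ω}) := measure_biUnion_finset_le _ _
    _ ≤ ∑ v ∈ s, 3 * q := by
        refine Finset.sum_le_sum fun v hv => (measure_union_le _ _).trans ?_
        have h1 := quadratic_lower_tail (hξ v) (hind v) hc (hsub v (hs1 v hv)) (hvar v (hs1 v hv))
          hM hL0 hL
        have := (hind v).isProbabilityMeasure
        -- The level r = tr M/(2L) makes the threshold 4c tr M, and its probability is dominated by
        -- the weaker rate `q` of the lower tail.
        have h2 := quadratic_upper_tail (hξ v) hc0
          (subGaussianMoments_of_iIndepFun (hind v) (hsub v (hs1 v hv))) hM hL0 hL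
          (M.trace / (2 * L))
        rw [show 2 * (c : ℝ) * M.trace + 4 * c * L * (M.trace / (2 * L)) = 4 * c * M.trace by
          field_simp; ring] at h2
        have h3 : ENNReal.ofReal (Real.exp (-(M.trace / (2 * L)))) ≤ q := by
          refine ENNReal.ofReal_le_ofReal (Real.exp_le_exp.2 (neg_le_neg ?_))
          gcongr
          nlinarith
        calc _ ≤ 2 * q + q := add_le_add h1 (h2.trans h3)
          _ = 3 * q := by ring
    _ = s.card * (3 * q) := by rw [Finset.sum_const, nsmul_eq_mul]
    _ ≤ _ := by
        rw [sub_eq_add_neg, Real.exp_add, Real.exp_nat_mul, Real.exp_log (by positivity)]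
        rw [show (3 : ENNReal) = ENNReal.ofReal 3 by simp, ← ENNReal.ofReal_mul (by norm_num),
          ← ENNReal.ofReal_natCast, ← ENNReal.ofReal_mul (by positivity)]
        apply ENNReal.ofReal_le_ofReal
        nlinarith [mul_le_mul_of_nonneg_right hcard
          (Real.exp_pos (-(M.trace / (3072 * (c : ℝ) ^ 2 * L)))).le]

end Nets

/-! ### Projections, traces and operator bounds. -/

section LinearAlgebra

variable {ι κ : Type*} [Fintype ι] [Fintype κ]

theorem dotProduct_self_nonneg' (v : ι → ℝ) : 0 ≤ v ⬝ᵥ v := dotProduct_self_star_nonneg v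

theorem dotProduct_sq_le (u v : ι → ℝ) : (u ⬝ᵥ v) ^ 2 ≤ (u ⬝ᵥ u) * (v ⬝ᵥ v) := by
  have := Finset.sum_mul_sq_le_sq_mul_sq Finset.univ u v
  simpa [dotProduct, pow_two] using this

theorem dotProduct_add_self_le (u v : ι → ℝ) :
    (u + v) ⬝ᵥ (u + v) ≤ 2 * (u ⬝ᵥ u) + 2 * (v ⬝ᵥ v) := by
  have := dotProduct_self_nonneg' (u - v)
  simp only [add_dotProduct, dotProduct_add, sub_dotProduct, dotProduct_sub] at this ⊢
  linarith [dotProduct_comm u v]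

theorem dotProduct_sub_self_le (u v : ι → ℝ) :
    (u - v) ⬝ᵥ (u - v) ≤ 2 * (u ⬝ᵥ u) + 2 * (v ⬝ᵥ v) := by
  have := dotProduct_self_nonneg' (u + v)
  simp only [add_dotProduct, dotProduct_add, sub_dotProduct, dotProduct_sub] at this ⊢
  linarith [dotProduct_comm u v]

theorem mulVec_dotProduct (G : Matrix ι κ ℝ) (v : κ → ℝ) (u : ι → ℝ) :
    (G *ᵥ v) ⬝ᵥ u = v ⬝ᵥ (Gᵀ *ᵥ u) := by
  rw [Matrix.dotProduct_mulVec, Matrix.vecMul_transpose]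

theorem mulVec_dotProduct_self (G : Matrix ι κ ℝ) (v : κ → ℝ) :
    (G *ᵥ v) ⬝ᵥ (G *ᵥ v) = v ⬝ᵥ (Gᵀ * G) *ᵥ v := by
  rw [mulVec_dotProduct, Matrix.mulVec_mulVec]

/-- A matrix and its transpose have the same norm: Cauchy–Schwarz on |Gv|² = ⟨v, GᵀGv⟩. -/
theorem mulVec_bound_of_transpose_bound {G : Matrix ι κ ℝ} {B : ℝ}
    (h : ∀ u, (Gᵀ *ᵥ u) ⬝ᵥ (Gᵀ *ᵥ u) ≤ B * (u ⬝ᵥ u)) (hB : 0 ≤ B) (v : κ → ℝ) :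
    (G *ᵥ v) ⬝ᵥ (G *ᵥ v) ≤ B * (v ⬝ᵥ v) := by
  set s := (G *ᵥ v) ⬝ᵥ (G *ᵥ v)
  have hs : 0 ≤ s := dotProduct_self_nonneg' _
  have h1 : s ^ 2 ≤ (v ⬝ᵥ v) * (B * s) := by
    have h2 := dotProduct_sq_le v (Gᵀ *ᵥ (G *ᵥ v))
    rw [← mulVec_dotProduct] at h2
    exact h2.trans (mul_le_mul_of_nonneg_left (h _) (dotProduct_self_nonneg' v))
  rcases hs.eq_or_lt with h0 | h0
  · rw [← h0]; exact mul_nonneg hB (dotProduct_self_nonneg' v)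
  · exact le_of_mul_le_mul_right (by nlinarith) h0

theorem projection_bound {Q : Matrix ι ι ℝ} (hs : Qᵀ = Q) (hi : Q * Q = Q) (v : ι → ℝ) :
    (Q *ᵥ v) ⬝ᵥ (Q *ᵥ v) ≤ v ⬝ᵥ v := by
  have h1 : (Q *ᵥ v) ⬝ᵥ (Q *ᵥ v) = v ⬝ᵥ Q *ᵥ v := by rw [mulVec_dotProduct_self, hs, hi]
  have h2 := dotProduct_self_nonneg' (v - Q *ᵥ v)
  simp only [sub_dotProduct, dotProduct_sub] at h2
  linarith [dotProduct_comm v (Q *ᵥ v)]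

/-- By cyclicity the trace is that of QSQ, whose i-th diagonal entry is the form of S at Qeᵢ, and
|Qeᵢ|² = Qᵢᵢ. -/
theorem trace_projection_mul_le [DecidableEq ι] {Q S : Matrix ι ι ℝ} (hs : Qᵀ = Q)
    (hi : Q * Q = Q) {L : ℝ} (hS : ∀ x, x ⬝ᵥ S *ᵥ x ≤ L * (x ⬝ᵥ x)) :
    (Q * S).trace ≤ L * Q.trace := by
  have h1 : (Q * S).trace = (Q * S * Q).trace := by
    rw [Matrix.trace_mul_comm (Q * S) Q, ← Matrix.mul_assoc, hi]
  rw [h1]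
  simp only [Matrix.trace, Matrix.diag, Finset.mul_sum]
  refine Finset.sum_le_sum fun i _ => ?_
  rw [diag_eq_dotProduct (Q * S * Q), diag_eq_dotProduct Q]
  have h2 := hS (Q *ᵥ Pi.single i 1)
  rw [mulVec_dotProduct_self, hs, hi, mulVec_dotProduct, hs, Matrix.mulVec_mulVec,
    Matrix.mulVec_mulVec] at h2
  exact h2

theorem isUnit_det_of_lower_bound [DecidableEq κ] {G : Matrix ι κ ℝ} {a : ℝ} (ha : 0 < a)
    (h : ∀ u, a * (u ⬝ᵥ u) ≤ (G *ᵥ u) ⬝ᵥ (G *ᵥ u)) : IsUnit (Gᵀ * G).det := by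
  rw [isUnit_iff_ne_zero]
  intro hdet
  obtain ⟨v, hv, hGv⟩ := Matrix.exists_mulVec_eq_zero_iff.2 hdet
  have h1 := h v
  rw [mulVec_dotProduct_self, hGv, dotProduct_zero] at h1
  have h2 : v ⬝ᵥ v ≤ 0 := by
    by_contra hcon
    push Not at hcon
    nlinarith
  exact hv (dotProduct_self_eq_zero.1 (le_antisymm h2 (dotProduct_self_nonneg' v)))

/-- The orthogonal projection onto the column space of a matrix of full column rank. -/
noncomputable def colProj [DecidableEq κ] (z : Matrix ι κ ℝ) : Matrix ι ι ℝ :=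
  z * (zᵀ * z)⁻¹ * zᵀ

section colProj

variable [DecidableEq κ] {z : Matrix ι κ ℝ}

theorem inv_gram_transpose : ((zᵀ * z)⁻¹)ᵀ = (zᵀ * z)⁻¹ := by
  rw [Matrix.transpose_nonsing_inv]; simp

theorem colProj_transpose : (colProj z)ᵀ = colProj z := by
  simp only [colProj, Matrix.transpose_mul, Matrix.transpose_transpose, inv_gram_transpose,
    Matrix.mul_assoc]

theorem colProj_mul_self (hz : IsUnit (zᵀ * z).det) : colProj z * z = z := by
  rw [colProj, Matrix.mul_assoc, Matrix.mul_assoc, Matrix.nonsing_inv_mul _ hz, Matrix.mul_one]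

theorem colProj_idem (hz : IsUnit (zᵀ * z).det) : colProj z * colProj z = colProj z := by
  conv_lhs => rhs; rw [colProj]
  rw [← Matrix.mul_assoc, ← Matrix.mul_assoc, colProj_mul_self hz, ← colProj]

theorem trace_colProj (hz : IsUnit (zᵀ * z).det) : (colProj z).trace = Fintype.card κ := by
  rw [colProj, Matrix.trace_mul_comm, ← Matrix.mul_assoc, Matrix.mul_nonsing_inv _ hz,
    Matrix.trace_one]

end colProj

end LinearAlgebra

/-! ### The Moore–Penrose inverse at full row rank. -/

section Pinv

variable {n p : ℕ} {x : Matrix (Fin n) (Fin p) ℝ}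

theorem mul_pinv_eq_one (hx : IsUnit (x * xᵀ).det) : x * pinv x = 1 := by
  obtain ⟨h1, -, -, -⟩ := pinv_penrose x
  have h2 : (x * pinv x) * (x * xᵀ) = 1 * (x * xᵀ) := by
    rw [← Matrix.mul_assoc, h1, Matrix.one_mul]
  calc x * pinv x = (x * pinv x) * (x * xᵀ) * (x * xᵀ)⁻¹ := by
        rw [Matrix.mul_nonsing_inv_cancel_right _ _ hx]
    _ = 1 := by rw [h2, Matrix.one_mul, Matrix.mul_nonsing_inv _ hx]

/-- The Penrose equations give x⁺ = xᵀ(x⁺ᵀx⁺), and the bracket is a right inverse of xxᵀ. This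
closed form also makes the predictor visibly measurable in the data. -/
theorem pinv_eq (hx : IsUnit (x * xᵀ).det) : pinv x = xᵀ * (x * xᵀ)⁻¹ := by
  obtain ⟨-, h2, -, h4⟩ := pinv_penrose x
  have h5 : pinv x = xᵀ * ((pinv x)ᵀ * pinv x) := by
    rw [← Matrix.mul_assoc, ← Matrix.transpose_mul, h4, h2]
  have h6 : x * xᵀ * ((pinv x)ᵀ * pinv x) = 1 := by
    rw [Matrix.mul_assoc, ← h5, mul_pinv_eq_one hx]
  rw [Matrix.inv_eq_right_inv h6]
  exact h5

/-- With u = (xxᵀ)⁻¹y, the quantity s = |x⁺y|² equals both |xᵀu|² and ⟨u, y⟩, so s² ≤ |u|²|y|² ≤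
(s/a)|y|². -/
theorem pinv_bound {a : ℝ} (ha : 0 < a)
    (h : ∀ u, a * (u ⬝ᵥ u) ≤ (xᵀ *ᵥ u) ⬝ᵥ (xᵀ *ᵥ u)) (y : Fin n → ℝ) :
    (pinv x *ᵥ y) ⬝ᵥ (pinv x *ᵥ y) ≤ a⁻¹ * (y ⬝ᵥ y) := by
  have hx : IsUnit (x * xᵀ).det := by simpa using isUnit_det_of_lower_bound ha h
  set u := (x * xᵀ)⁻¹ *ᵥ y
  have e1 : pinv x *ᵥ y = xᵀ *ᵥ u := by rw [pinv_eq hx, Matrix.mulVec_mulVec]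
  have e2 : (xᵀ *ᵥ u) ⬝ᵥ (xᵀ *ᵥ u) = u ⬝ᵥ y := by
    rw [mulVec_dotProduct_self, Matrix.transpose_transpose, Matrix.mulVec_mulVec,
      Matrix.mul_nonsing_inv _ hx, Matrix.one_mulVec]
  rw [e1]
  have h1 := h u
  have h2 := dotProduct_sq_le u y
  rw [← e2] at h2
  set s := (xᵀ *ᵥ u) ⬝ᵥ (xᵀ *ᵥ u)
  have hs : 0 ≤ s := dotProduct_self_nonneg' _
  have hy := dotProduct_self_nonneg' y
  rw [inv_mul_eq_div, le_div_iff₀ ha]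
  rcases hs.eq_or_lt with h0 | h0
  · rw [← h0]; linarith
  · refine le_of_mul_le_mul_right (?_ : s * a * s ≤ (y ⬝ᵥ y) * s) h0
    nlinarith

/-- x⁺x is an orthogonal projection. The bound is free of the size of x, so a strong signal zAᵀ
costs nothing. -/
theorem pinv_mul_bound (v : Fin p → ℝ) :
    (pinv x *ᵥ (x *ᵥ v)) ⬝ᵥ (pinv x *ᵥ (x *ᵥ v)) ≤ v ⬝ᵥ v := by
  obtain ⟨h1, -, -, h4⟩ := pinv_penrose x
  rw [Matrix.mulVec_mulVec]
  refine projection_bound h4 ?_ v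
  rw [Matrix.mul_assoc, ← Matrix.mul_assoc x, h1]

end Pinv

/-! ### Deterministic bound for the excess risk. -/

section ExcessRisk

variable {n p K : ℕ} {z : Matrix (Fin n) (Fin K) ℝ} {w : Matrix (Fin n) (Fin p) ℝ}
  {A : Matrix (Fin p) (Fin K) ℝ} {a B : ℝ}

/-- For N = w x⁺ - 1 the transpose is bounded because N Nᵀ is what enters the trace of `noiseForm`.
-/
theorem noise_operator_transpose_bound (ha : 0 < a)
    (hx : ∀ u, a * (u ⬝ᵥ u) ≤ ((z * Aᵀ + w)ᵀ *ᵥ u) ⬝ᵥ ((z * Aᵀ + w)ᵀ *ᵥ u))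
    (hw : ∀ u, (wᵀ *ᵥ u) ⬝ᵥ (wᵀ *ᵥ u) ≤ B * (u ⬝ᵥ u)) (u : Fin n → ℝ) :
    ((w * pinv (z * Aᵀ + w) - 1)ᵀ *ᵥ u) ⬝ᵥ ((w * pinv (z * Aᵀ + w) - 1)ᵀ *ᵥ u)
      ≤ 2 * (B / a + 1) * (u ⬝ᵥ u) := by
  set J := pinv (z * Aᵀ + w)
  have hJ : ∀ v, (Jᵀ *ᵥ v) ⬝ᵥ (Jᵀ *ᵥ v) ≤ a⁻¹ * (v ⬝ᵥ v) :=
    mulVec_bound_of_transpose_bound (fun y => by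
      rw [Matrix.transpose_transpose]; exact pinv_bound ha hx y) (inv_pos.2 ha).le
  have h1 : (w * J - 1)ᵀ *ᵥ u = Jᵀ *ᵥ (wᵀ *ᵥ u) - u := by
    rw [Matrix.transpose_sub, Matrix.transpose_mul, Matrix.sub_mulVec, Matrix.mulVec_mulVec,
      Matrix.transpose_one, Matrix.one_mulVec]
  rw [h1]
  refine (dotProduct_sub_self_le _ _).trans ?_
  have h2 := (hJ (wᵀ *ᵥ u)).trans (mul_le_mul_of_nonneg_left (hw u) (inv_pos.2 ha).le)
  have h3 : a⁻¹ * (B * (u ⬝ᵥ u)) = B / a * (u ⬝ᵥ u) := by field_simp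
  linarith

/-- The matrix of the quadratic form `e ↦ |Π (W X⁺ - 1) e|²`, with `Π` the orthogonal projection
onto the column space of `Z`. -/
noncomputable def noiseForm (z : Matrix (Fin n) (Fin K) ℝ) (w : Matrix (Fin n) (Fin p) ℝ)
    (A : Matrix (Fin p) (Fin K) ℝ) : Matrix (Fin n) (Fin n) ℝ :=
  (colProj z * (w * pinv (z * Aᵀ + w) - 1))ᵀ * (colProj z * (w * pinv (z * Aᵀ + w) - 1))

theorem transpose_mul_self_posSemidef {ι κ : Type*} [Fintype ι] [Fintype κ] (G : Matrix ι κ ℝ) :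
    (Gᵀ * G).PosSemidef := by
  have := Matrix.posSemidef_conjTranspose_mul_self G
  rwa [Matrix.conjTranspose_eq_transpose_of_trivial] at this

/-- The trace is that of Π N Nᵀ with Π a projection of rank K, hence at most K times the bound for N
Nᵀ. This is where the dimension K replaces n. -/
theorem noiseForm_bounds (ha : 0 < a) (hB : 0 ≤ B) (hz : IsUnit (zᵀ * z).det)
    (hx : ∀ u, a * (u ⬝ᵥ u) ≤ ((z * Aᵀ + w)ᵀ *ᵥ u) ⬝ᵥ ((z * Aᵀ + w)ᵀ *ᵥ u))
    (hw : ∀ u, (wᵀ *ᵥ u) ⬝ᵥ (wᵀ *ᵥ u) ≤ B * (u ⬝ᵥ u)) :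
    (∀ v, v ⬝ᵥ noiseForm z w A *ᵥ v ≤ 2 * (B / a + 1) * (v ⬝ᵥ v)) ∧
      (noiseForm z w A).trace ≤ 2 * (B / a + 1) * K := by
  have hN := noise_operator_transpose_bound ha hx hw
  set N := w * pinv (z * Aᵀ + w) - 1
  have h0 : 0 ≤ 2 * (B / a + 1) := by positivity
  constructor
  · intro v
    rw [noiseForm, ← mulVec_dotProduct_self, ← Matrix.mulVec_mulVec]
    exact (projection_bound colProj_transpose (colProj_idem hz) _).trans
      (mulVec_bound_of_transpose_bound hN h0 v)
  · have h1 : (noiseForm z w A).trace = (colProj z * (N * Nᵀ)).trace := by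
      rw [noiseForm, Matrix.trace_mul_comm, Matrix.transpose_mul, colProj_transpose,
        Matrix.trace_mul_comm, Matrix.mul_assoc, ← Matrix.mul_assoc (colProj z) (colProj z),
        colProj_idem hz, Matrix.trace_mul_comm, Matrix.mul_assoc]
    rw [h1]
    refine (trace_projection_mul_le colProj_transpose (colProj_idem hz) (L := 2 * (B / a + 1))
      fun x => ?_).trans (le_of_eq ?_)
    · have := hN x
      rwa [mulVec_dotProduct_self, Matrix.transpose_transpose] at this
    · rw [trace_colProj hz, Fintype.card_fin]

variable {β : Fin K → ℝ} {SZ : Matrix (Fin K) (Fin K) ℝ} {SW : Matrix (Fin p) (Fin p) ℝ} {N L : ℝ}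

/-- Deterministic bound for the excess risk of the minimum-norm predictor. -/
theorem excess_le (ha : 0 < a) (hB : 0 ≤ B) (hL : 0 ≤ L) (hA : IsUnit (Aᵀ * A).det)
    (hz : IsUnit (zᵀ * z).det)
    (hx : ∀ u, a * (u ⬝ᵥ u) ≤ ((z * Aᵀ + w)ᵀ *ᵥ u) ⬝ᵥ ((z * Aᵀ + w)ᵀ *ᵥ u))
    (hw : ∀ u, (wᵀ *ᵥ u) ⬝ᵥ (wᵀ *ᵥ u) ≤ B * (u ⬝ᵥ u))
    (hZ : ∀ u, N * (u ⬝ᵥ SZ *ᵥ u) ≤ (z *ᵥ u) ⬝ᵥ (z *ᵥ u)) (hN : 0 < N)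
    (hW : ∀ v, v ⬝ᵥ SW *ᵥ v ≤ L * (v ⬝ᵥ v)) (e : Fin n → ℝ)
    {α : Fin p → ℝ} (hα : α = pinv (z * Aᵀ + w) *ᵥ (z *ᵥ β + e)) :
    (β - Aᵀ *ᵥ α) ⬝ᵥ SZ *ᵥ (β - Aᵀ *ᵥ α) + α ⬝ᵥ SW *ᵥ α ≤
      4 * (1 + B / a) * (B / N + L) * (β ⬝ᵥ (Aᵀ * A)⁻¹ *ᵥ β)
        + 2 / N * (e ⬝ᵥ noiseForm z w A *ᵥ e) + 2 * L / a * (e ⬝ᵥ e) := by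
  set x := z * Aᵀ + w with hxdef
  set J := pinv x
  have hxu : IsUnit (x * xᵀ).det := by simpa using isUnit_det_of_lower_bound ha hx
  -- The minimum-norm solution of Aᵀb = β: it turns zβ into xb - wb, and x⁺ contracts the first
  -- term.
  set b := A *ᵥ ((Aᵀ * A)⁻¹ *ᵥ β)
  have hAb : Aᵀ *ᵥ b = β := by
    rw [Matrix.mulVec_mulVec, Matrix.mulVec_mulVec, Matrix.mul_nonsing_inv _ hA,
      Matrix.one_mulVec]
  have hbb : b ⬝ᵥ b = β ⬝ᵥ (Aᵀ * A)⁻¹ *ᵥ β := by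
    rw [mulVec_dotProduct, hAb, dotProduct_comm]
  have hw' := mulVec_bound_of_transpose_bound hw hB
  have hzβ : z *ᵥ β = x *ᵥ b - w *ᵥ b := by
    rw [hxdef, Matrix.add_mulVec, ← Matrix.mulVec_mulVec, hAb, add_sub_cancel_right]
  set s := J *ᵥ (z *ᵥ β)
  set t := J *ᵥ e
  have hαst : α = s + t := by rw [hα, Matrix.mulVec_add]
  have hb0 := dotProduct_self_nonneg' b
  have hs : s ⬝ᵥ s ≤ 2 * (1 + B / a) * (b ⬝ᵥ b) := by
    have h1 : s = J *ᵥ (x *ᵥ b) - J *ᵥ (w *ᵥ b) := by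
      simp only [s]; rw [hzβ, Matrix.mulVec_sub]
    rw [h1]
    refine (dotProduct_sub_self_le _ _).trans ?_
    have h2 := pinv_mul_bound (x := x) b
    have h3 := (pinv_bound ha hx (w *ᵥ b)).trans
      (mul_le_mul_of_nonneg_left (hw' b) (inv_pos.2 ha).le)
    have h4 : a⁻¹ * (B * (b ⬝ᵥ b)) = B / a * (b ⬝ᵥ b) := by field_simp
    linarith
  have ht : t ⬝ᵥ t ≤ a⁻¹ * (e ⬝ᵥ e) := pinv_bound ha hx e
  have hαα : α ⬝ᵥ SW *ᵥ α ≤ L * (4 * (1 + B / a) * (b ⬝ᵥ b) + 2 * (a⁻¹ * (e ⬝ᵥ e))) := by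
    refine (hW α).trans (mul_le_mul_of_nonneg_left ?_ hL)
    rw [hαst]
    refine (dotProduct_add_self_le _ _).trans ?_
    linarith
  set δ := β - Aᵀ *ᵥ α
  have hzδ : z *ᵥ δ = w *ᵥ α - e := by
    have h1 : x *ᵥ α = z *ᵥ β + e := by
      rw [hα, Matrix.mulVec_mulVec, mul_pinv_eq_one hxu, Matrix.one_mulVec]
    have h2 : z *ᵥ (Aᵀ *ᵥ α) = x *ᵥ α - w *ᵥ α := by
      rw [hxdef, Matrix.add_mulVec, Matrix.mulVec_mulVec, add_sub_cancel_right]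
    simp only [δ]
    rw [Matrix.mulVec_sub, h2, h1]
    abel
  -- Π fixes zδ, so it may be applied to wα - e before any norm is taken. With α = s + t and t =
  -- x⁺e, the noise terms combine into Π(w x⁺ - 1)e.
  have hzδ2 : z *ᵥ δ = colProj z *ᵥ (w *ᵥ s) + (colProj z * (w * J - 1)) *ᵥ e := by
    have h1 : z *ᵥ δ = colProj z *ᵥ (z *ᵥ δ) := by
      rw [Matrix.mulVec_mulVec, colProj_mul_self hz]
    rw [h1, hzδ, hαst, Matrix.mulVec_add w s t, ← Matrix.mulVec_mulVec e (colProj z),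
      ← Matrix.mulVec_add (colProj z), Matrix.sub_mulVec, Matrix.one_mulVec,
      ← Matrix.mulVec_mulVec e, add_sub_assoc]
  have hδ : N * (δ ⬝ᵥ SZ *ᵥ δ) ≤
      2 * (B * (2 * (1 + B / a) * (b ⬝ᵥ b))) + 2 * (e ⬝ᵥ noiseForm z w A *ᵥ e) := by
    refine (hZ δ).trans ?_
    rw [hzδ2]
    refine (dotProduct_add_self_le _ _).trans ?_
    rw [noiseForm, ← mulVec_dotProduct_self (colProj z * (w * J - 1))]
    have h1 := (projection_bound colProj_transpose (colProj_idem hz) (w *ᵥ s)).trans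
      ((hw' s).trans (mul_le_mul_of_nonneg_left hs hB))
    linarith
  have hδ2 : δ ⬝ᵥ SZ *ᵥ δ ≤
      (2 * (B * (2 * (1 + B / a) * (b ⬝ᵥ b))) + 2 * (e ⬝ᵥ noiseForm z w A *ᵥ e)) / N := by
    rw [le_div_iff₀ hN]; linarith
  rw [← hbb]
  refine (add_le_add hδ2 hαα).trans (le_of_eq ?_)
  field_simp
  ring

end ExcessRisk

/-! ### Matrices with independent rows or independent entries. -/

section RandomMatrices

variable {Ω : Type*} [MeasurableSpace Ω] {P : Measure Ω}

theorem hasSubgaussianMGF_mono {y : Ω → ℝ} {c c' : NNReal} (h : HasSubgaussianMGF y c P)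
    (hc : c ≤ c') : HasSubgaussianMGF y c' P where
  integrable_exp_mul := h.integrable_exp_mul
  mgf_le t := (h.mgf_le t).trans <| Real.exp_le_exp.2 <| by
    have : (c : ℝ) ≤ c' := hc
    gcongr

theorem IsCenteredWithCov.integrable_mul {d : ℕ} {x : Ω → Fin d → ℝ} {S : Matrix (Fin d) (Fin d) ℝ}
    (h : IsCenteredWithCov x S P) (i j : Fin d) : Integrable (fun ω => x ω i * x ω j) P :=
  (h.memLp i).integrable_mul (h.memLp j)

theorem IsCenteredWithCov.memLp_dotProduct {d : ℕ} {x : Ω → Fin d → ℝ}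
    {S : Matrix (Fin d) (Fin d) ℝ} (h : IsCenteredWithCov x S P) (v : Fin d → ℝ) :
    MemLp (fun ω => x ω ⬝ᵥ v) 2 P := by
  simp only [dotProduct]
  refine memLp_finsetSum _ fun i _ => ?_
  simpa only [mul_comm] using (h.memLp i).const_mul (v i)

theorem IsCenteredWithCov.integral_dotProduct_sq {d : ℕ} {x : Ω → Fin d → ℝ}
    {S : Matrix (Fin d) (Fin d) ℝ} (h : IsCenteredWithCov x S P) (v : Fin d → ℝ) :
    ∫ ω, (x ω ⬝ᵥ v) ^ 2 ∂P = v ⬝ᵥ S *ᵥ v := by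
  have h1 : ∀ ω, (x ω ⬝ᵥ v) ^ 2 = ∑ i, ∑ j, (v i * v j) * (x ω i * x ω j) := by
    intro ω
    simp only [dotProduct, pow_two, Finset.sum_mul_sum]
    exact Finset.sum_congr rfl fun i _ => Finset.sum_congr rfl fun j _ => by ring
  simp_rw [h1]
  rw [integral_finsetSum _ fun i _ => integrable_finsetSum _ fun j _ =>
    (h.integrable_mul i j).const_mul _]
  simp only [dotProduct, Matrix.mulVec, Finset.mul_sum]
  refine Finset.sum_congr rfl fun i _ => ?_
  rw [integral_finsetSum _ fun j _ => (h.integrable_mul i j).const_mul _]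
  refine Finset.sum_congr rfl fun j _ => ?_
  rw [integral_const_mul, h.second_moment]; ring

theorem IsCenteredWithCov.integral_dotProduct [IsFiniteMeasure P] {d : ℕ} {x : Ω → Fin d → ℝ}
    {S : Matrix (Fin d) (Fin d) ℝ} (h : IsCenteredWithCov x S P) (v : Fin d → ℝ) :
    ∫ ω, x ω ⬝ᵥ v ∂P = 0 := by
  simp only [dotProduct]
  rw [integral_finsetSum _ fun i _ => ((h.memLp i).integrable one_le_two).mul_const _]
  exact Finset.sum_eq_zero fun i _ => by rw [integral_mul_const, h.mean_zero, zero_mul]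

theorem IsCenteredWithCov.posSemidef {d : ℕ} {x : Ω → Fin d → ℝ} {S : Matrix (Fin d) (Fin d) ℝ}
    (h : IsCenteredWithCov x S P) : S.PosSemidef := by
  refine Matrix.PosSemidef.of_dotProduct_mulVec_nonneg ?_ fun v => ?_
  · ext i j
    simp only [Matrix.conjTranspose_apply, star_trivial]
    rw [← h.second_moment, ← h.second_moment]
    simp only [mul_comm]
  · rw [star_trivial, ← h.integral_dotProduct_sq]
    exact integral_nonneg fun ω => sq_nonneg _

/-- Independence is a statement about product laws, and currying a product measure gives the product
of the block laws. -/
theorem iIndepFun_curry {ι κ : Type*} {Y : ι × κ → Ω → ℝ} (hm : ∀ q, Measurable (Y q))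
    (hY : iIndepFun Y P) : iIndepFun (fun i ω k => Y (i, k) ω) P := by
  have := hY.isProbabilityMeasure
  have hprob : ∀ i k, IsProbabilityMeasure (P.map (Y (i, k))) := fun i k =>
    Measure.isProbabilityMeasure_map (hm _).aemeasurable
  rw [iIndepFun_iff_map_fun_eq_infinitePi_map (by fun_prop)]
  have h1 : (fun ω i k => Y (i, k) ω) =
      (MeasurableEquiv.curry ι κ ℝ) ∘ fun ω q => Y q ω := rfl
  rw [h1, ← Measure.map_map (by fun_prop) (by fun_prop),
    (iIndepFun_iff_map_fun_eq_infinitePi_map hm).1 hY]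
  have h2 := Measure.infinitePi_map_curry (fun i k => P.map (Y (i, k)))
  rw [h2]
  congr 1
  funext i
  have h3 : iIndepFun (fun k => Y (i, k)) P := hY.precomp (g := fun k => (i, k)) (Prod.mk_right_injective i)
  exact ((iIndepFun_iff_map_fun_eq_infinitePi_map fun k => hm _).1 h3).symm

variable [IsProbabilityMeasure P] {n : ℕ}

theorem hasSubgaussianMGF_eval {y : Ω → ℝ} {c : NNReal} (h : HasSubgaussianMGF y c P)
    (i : Fin n) :
    HasSubgaussianMGF (fun ω : Fin n → Ω => y (ω i)) c (Measure.pi fun _ => P) := by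
  refine HasSubgaussianMGF.of_map (X := y) (Y := fun ω : Fin n → Ω => ω i)
    (measurable_pi_apply i).aemeasurable ?_
  rw [(measurePreserving_eval (fun _ : Fin n => P) i).map_eq]
  exact h

theorem integral_eval {f : Ω → ℝ} (hf : AEStronglyMeasurable f P) (i : Fin n) :
    ∫ ω : Fin n → Ω, f (ω i) ∂(Measure.pi fun _ => P) = ∫ ω, f ω ∂P := by
  have hmp := measurePreserving_eval (fun _ : Fin n => P) i
  have h := integral_map (μ := Measure.pi fun _ : Fin n => P) hmp.measurable.aemeasurable
    (f := f) (by rw [hmp.map_eq]; exact hf)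
  rw [hmp.map_eq] at h
  exact h.symm

theorem memLp_eval {f : Ω → ℝ} (hf : MemLp f 2 P) (i : Fin n) :
    MemLp (fun ω : Fin n → Ω => f (ω i)) 2 (Measure.pi fun _ => P) :=
  hf.comp_measurePreserving (measurePreserving_eval (fun _ : Fin n => P) i)

theorem isCenteredWithCov_copies {y : Ω → ℝ} (hm : Measurable y) (hy : MemLp y 2 P)
    (h0 : ∫ ω, y ω ∂P = 0) (h1 : ∫ ω, y ω ^ 2 ∂P = 1) :
    IsCenteredWithCov (fun (ω : Fin n → Ω) i => y (ω i)) 1 (Measure.pi fun _ => P) where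
  memLp i := memLp_eval hy i
  mean_zero i := by rw [integral_eval hm.aestronglyMeasurable, h0]
  second_moment i j := by
    by_cases hij : i = j
    · subst hij
      have h := integral_eval (P := P) (n := n) (f := fun ω => y ω ^ 2)
        (hm.pow_const 2).aestronglyMeasurable i
      rw [Matrix.one_apply_eq, ← h1, ← h]
      simp only [pow_two]
    · have hind : iIndepFun (fun (i : Fin n) (ω : Fin n → Ω) => y (ω i)) (Measure.pi fun _ => P) :=
        iIndepFun_pi fun _ => hm.aemeasurable
      rw [Matrix.one_apply_ne hij]
      have := (hind.indepFun hij).integral_fun_mul_eq_mul_integral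
        (hm.comp (measurable_pi_apply i)).aestronglyMeasurable
        (hm.comp (measurable_pi_apply j)).aestronglyMeasurable
      rw [this, integral_eval hm.aestronglyMeasurable, h0, zero_mul]

/-- A matrix with independent isotropic sub-Gaussian rows is well conditioned. -/
theorem measure_isotropic_rows_le {K : ℕ} {x : Ω → Fin K → ℝ} (hx : Measurable x) {γ : ℝ}
    (hsub : IsSubGaussianVector x γ P) (hcov : IsCenteredWithCov x 1 P) {c : NNReal} (hc : 1 ≤ c)
    (hγ : (γ ^ 2).toNNReal ≤ c) :
    (Measure.pi fun _ : Fin n => P) {ω | ¬ ∀ u, (n : ℝ) / 8 * (u ⬝ᵥ u) ≤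
        (Matrix.of (fun i => x (ω i)) *ᵥ u) ⬝ᵥ (Matrix.of (fun i => x (ω i)) *ᵥ u)} ≤
      ENNReal.ofReal (3 * Real.exp (K * Real.log (33 * c) - n / (3072 * (c : ℝ) ^ 2))) := by
  have hdm : ∀ v : Fin K → ℝ, Measurable fun ω => x ω ⬝ᵥ v := fun v => by
    simp only [dotProduct]; fun_prop
  have h := measure_not_wellConditioned_le (P := Measure.pi fun _ : Fin n => P)
    (ι := Fin n) (κ := Fin n) (fun ω : Fin n → Ω => Matrix.of fun i => x (ω i)) hc (M := 1)
    -- For fixed v the variables ⟨xᵢ, v⟩ are independent over the rows i, so the form is that of the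
    -- n × n identity; independence inside a row is not needed.
    Matrix.PosSemidef.one (L := 1) one_pos (fun y => by simp) (fun v ω i => x (ω i) ⬝ᵥ v)
    (fun v ω => by rw [Matrix.one_mulVec]; rfl)
    (fun v => measurable_pi_lambda _ fun i => (hdm v).comp (measurable_pi_apply i))
    (fun v => iIndepFun_pi fun _ => (hdm v).aemeasurable)
    (fun v hv i => hasSubgaussianMGF_eval (hasSubgaussianMGF_mono (hsub v hv) hγ) i)
    (fun v hv i => by
      rw [integral_eval (f := fun ω => (x ω ⬝ᵥ v) ^ 2) ((hdm v).pow_const 2).aestronglyMeasurable,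
        hcov.integral_dotProduct_sq, Matrix.one_mulVec, hv])
  simp only [Matrix.trace_one, Fintype.card_fin, mul_one] at h
  refine le_trans (measure_mono fun ω hω => ?_) h
  simp only [Set.mem_ofPred_eq] at hω ⊢
  exact fun hcon => hω fun u => (hcon u).1

/-- Rows are independent and so are the entries of each row, hence all entries are; regrouped by
columns, they give independent blocks, and each combination depends on one block. -/
theorem iIndepFun_combination {p : ℕ} {x : Ω → Fin p → ℝ} (hx : Measurable x)
    (hind : iIndepFun (fun j ω => x ω j) P) (v : Fin n → ℝ) :
    iIndepFun (fun (j : Fin p) (ω : Fin n → Ω) => ∑ i, v i * x (ω i) j)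
      (Measure.pi fun _ => P) := by
  have hm : ∀ j, Measurable fun ω => x ω j := fun j => (measurable_pi_apply j).comp hx
  have h1 : iIndepFun (fun (q : Fin n × Fin p) (ω : Fin n → Ω) => x (ω q.1) q.2)
      (Measure.pi fun _ => P) := by
    refine iIndepFun_uncurry' (X := fun i j (ω : Fin n → Ω) => x (ω i) j)
      (fun i j => (hm j).comp (measurable_pi_apply i)) ?_ fun i => ?_
    · exact iIndepFun_pi (X := fun _ : Fin n => x) fun _ => hx.aemeasurable
    · have hmp := measurePreserving_eval (fun _ : Fin n => P) i
      have hm' : ∀ j, AEMeasurable (fun ω : Fin n → Ω => x (ω i) j) (Measure.pi fun _ => P) :=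
        fun j => ((hm j).comp (measurable_pi_apply i)).aemeasurable
      rw [iIndepFun_iff_map_fun_eq_pi_map hm']
      have e1 : ∀ j, (Measure.pi fun _ : Fin n => P).map (fun ω => x (ω i) j)
          = P.map fun ω => x ω j := fun j => by
        rw [← hmp.map_eq, Measure.map_map (hm j) hmp.measurable, hmp.map_eq]; rfl
      have e2 : (Measure.pi fun _ : Fin n => P).map (fun ω j => x (ω i) j)
          = P.map fun ω j => x ω j := by
        rw [← hmp.map_eq, Measure.map_map hx hmp.measurable, hmp.map_eq]; rfl
      rw [e2]
      simp_rw [e1]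
      exact (iIndepFun_iff_map_fun_eq_pi_map fun j => (hm j).aemeasurable).1 hind
  have h2 : iIndepFun (fun (q : Fin p × Fin n) (ω : Fin n → Ω) => x (ω q.2) q.1)
      (Measure.pi fun _ => P) := h1.precomp (g := Prod.swap) Prod.swap_injective
  have h3 := iIndepFun_curry (fun q => (hm q.1).comp (measurable_pi_apply q.2)) h2
  exact h3.comp (fun _ r => ∑ i, v i * r i) fun _ => by fun_prop

/-- A linear image of a matrix with independent standardized sub-Gaussian entries is well
conditioned if the effective rank of the linear map is large. -/
theorem measure_independent_entries_le {p q : ℕ} {x : Ω → Fin p → ℝ} (hx : Measurable x)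
    {γ : ℝ} (hsub : IsSubGaussianVector x γ P) (hcov : IsCenteredWithCov x 1 P)
    (hind : iIndepFun (fun j ω => x ω j) P) {c : NNReal} (hc : 1 ≤ c)
    (hγ : (γ ^ 2).toNNReal ≤ c) (B : Matrix (Fin q) (Fin p) ℝ) {L : ℝ} (hL0 : 0 < L)
    (hL : ∀ y, y ⬝ᵥ (Bᵀ * B) *ᵥ y ≤ L * (y ⬝ᵥ y)) :
    (Measure.pi fun _ : Fin n => P) {ω | ¬ ∀ u, (Bᵀ * B).trace / 8 * (u ⬝ᵥ u) ≤
        ((B * (Matrix.of fun i => x (ω i))ᵀ) *ᵥ u) ⬝ᵥ ((B * (Matrix.of fun i => x (ω i))ᵀ) *ᵥ u) ∧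
        ((B * (Matrix.of fun i => x (ω i))ᵀ) *ᵥ u) ⬝ᵥ ((B * (Matrix.of fun i => x (ω i))ᵀ) *ᵥ u) ≤
          16 * c * (Bᵀ * B).trace * (u ⬝ᵥ u)} ≤
      ENNReal.ofReal (3 * Real.exp (n * Real.log (33 * c)
        - (Bᵀ * B).trace / (3072 * (c : ℝ) ^ 2 * L))) := by
  have hm : ∀ j, Measurable fun ω => x ω j := fun j => (measurable_pi_apply j).comp hx
  have hsubj : ∀ j, HasSubgaussianMGF (fun ω => x ω j) c P := fun j => by
    have := hsub (Pi.single j 1) (by simp)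
    simp only [dotProduct_single, mul_one] at this
    exact hasSubgaussianMGF_mono this hγ
  refine measure_not_wellConditioned_le (P := Measure.pi fun _ : Fin n => P)
    (ι := Fin p) (κ := Fin q) (fun ω : Fin n → Ω => B * (Matrix.of fun i => x (ω i))ᵀ) hc
    (transpose_mul_self_posSemidef B) hL0 hL (fun v ω j => ∑ i, v i * x (ω i) j) ?_ ?_ ?_ ?_ ?_
  · intro v ω
    have : (Matrix.of fun i => x (ω i))ᵀ *ᵥ v = fun j => ∑ i, v i * x (ω i) j := by
      funext j
      simp [Matrix.mulVec, dotProduct, mul_comm]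
    rw [← Matrix.mulVec_mulVec, this, mulVec_dotProduct_self]
  · intro v
    fun_prop
  · intro v
    exact iIndepFun_combination hx hind v
  · intro v hv j
    have hs := HasSubgaussianMGF.sum_of_iIndepFun (μ := Measure.pi fun _ : Fin n => P)
      (X := fun i ω => v i * x (ω i) j) (s := Finset.univ)
      (iIndepFun_pi (X := fun i ω => v i * x ω j) fun i => ((hm j).const_mul _).aemeasurable)
      (fun i _ => (hasSubgaussianMGF_eval (hsubj j) i).const_mul (v i))
    refine hasSubgaussianMGF_mono hs (le_of_eq ?_)
    ext
    rw [NNReal.coe_sum]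
    change ∑ i, v i ^ 2 * (c : ℝ) = c
    rw [← Finset.sum_mul]
    have : ∑ i, v i ^ 2 = 1 := by
      rw [← hv]; exact Finset.sum_congr rfl fun i _ => pow_two _
    rw [this, one_mul]
  · intro v hv j
    have h2 : ∫ ω, x ω j ^ 2 ∂P = 1 := by
      have := hcov.second_moment j j
      rw [Matrix.one_apply_eq] at this
      simpa only [pow_two] using this
    have h3 := (isCenteredWithCov_copies (n := n) (hm j) (hcov.memLp j) (hcov.mean_zero j)
      h2).integral_dotProduct_sq v
    rw [Matrix.one_mulVec, hv] at h3
    simpa only [dotProduct, mul_comm] using h3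

end RandomMatrices

/-! ### Operator norm, effective rank and the rank conditions. -/

section Parameters

variable {p : ℕ}

theorem opNorm_nonneg (S : Matrix (Fin p) (Fin p) ℝ) : 0 ≤ opNorm S := norm_nonneg _

theorem dotProduct_mulVec_le_opNorm (S : Matrix (Fin p) (Fin p) ℝ) (v : Fin p → ℝ) :
    v ⬝ᵥ S *ᵥ v ≤ opNorm S * (v ⬝ᵥ v) := by
  set f := Matrix.toEuclideanCLM (n := Fin p) (𝕜 := ℝ) S
  have h1 : v ⬝ᵥ S *ᵥ v = inner ℝ (WithLp.toLp 2 v) (f (WithLp.toLp 2 v)) := by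
    rw [EuclideanSpace.inner_eq_star_dotProduct, star_trivial, dotProduct_comm]
    rfl
  rw [h1, ← norm_toLp_sq]
  refine (real_inner_le_norm _ _).trans ?_
  have h2 := f.le_opNorm (WithLp.toLp 2 v)
  calc ‖WithLp.toLp 2 v‖ * ‖f (WithLp.toLp 2 v)‖
      ≤ ‖WithLp.toLp 2 v‖ * (‖f‖ * ‖WithLp.toLp 2 v‖) := by gcongr
    _ = opNorm S * ‖WithLp.toLp 2 v‖ ^ 2 := by rw [opNorm]; ring

/-- Division by zero gives 0, so a positive effective rank rules out a vanishing norm. -/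
theorem opNorm_pos_of_effRank_pos {S : Matrix (Fin p) (Fin p) ℝ} (h : 0 < effRank S) :
    0 < opNorm S := by
  refine lt_of_le_of_ne (opNorm_nonneg S) fun h0 => ?_
  rw [effRank, ← h0, div_zero] at h
  exact lt_irrefl _ h

open scoped MatrixOrder in
theorem sqrt_mul_sqrt_of_posSemidef {S : Matrix (Fin p) (Fin p) ℝ} (hS : S.PosSemidef) :
    CFC.sqrt S * CFC.sqrt S = S :=
  CFC.sqrt_mul_sqrt_self S (Matrix.nonneg_iff_posSemidef.2 hS)

open scoped MatrixOrder in
theorem sqrt_transpose (S : Matrix (Fin p) (Fin p) ℝ) : (CFC.sqrt S)ᵀ = CFC.sqrt S :=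
  posSemidef_transpose_eq (Matrix.nonneg_iff_posSemidef.1 (CFC.sqrt_nonneg S))

theorem eq_zero_of_mulVec_eq_zero_of_rank {q : ℕ} {M : Matrix (Fin q) (Fin q) ℝ}
    (h : M.rank = q) {v : Fin q → ℝ} (hv : M *ᵥ v = 0) : v = 0 := by
  have hsurj : Function.Surjective M.mulVecLin := by
    rw [← LinearMap.range_eq_top]
    apply Submodule.eq_top_of_finrank_eq
    rw [← Matrix.rank, h, Module.finrank_fin_fun]
  have hinj := LinearMap.injective_iff_surjective.2 hsurj
  exact hinj (by simpa using hv)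

theorem isUnit_det_gram_of_rank {q : ℕ} {A : Matrix (Fin p) (Fin q) ℝ} (h : A.rank = q) :
    IsUnit (Aᵀ * A).det := by
  rw [isUnit_iff_ne_zero]
  intro hdet
  obtain ⟨v, hv, hAv⟩ := Matrix.exists_mulVec_eq_zero_iff.2 hdet
  exact hv (eq_zero_of_mulVec_eq_zero_of_rank (by rw [Matrix.rank_transpose_mul_self, h]) hAv)

end Parameters

/-! ### Decomposition of the prediction risk. -/

section Risk

theorem integral_sq_sum_of_uncorrelated {Ω : Type*} [MeasurableSpace Ω] {P : Measure Ω}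
    {f g h : Ω → ℝ} (hf : MemLp f 2 P) (hg : MemLp g 2 P)
    (hh : MemLp h 2 P) (hfg : ∫ ω, f ω * g ω ∂P = 0) (hfh : ∫ ω, f ω * h ω ∂P = 0)
    (hgh : ∫ ω, g ω * h ω ∂P = 0) :
    ∫ ω, (f ω - g ω + h ω) ^ 2 ∂P
      = ∫ ω, f ω ^ 2 ∂P + ∫ ω, g ω ^ 2 ∂P + ∫ ω, h ω ^ 2 ∂P := by
  have ifg : Integrable (fun ω => f ω * g ω) P := hf.integrable_mul hg
  have ifh : Integrable (fun ω => f ω * h ω) P := hf.integrable_mul hh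
  have igh : Integrable (fun ω => g ω * h ω) P := hg.integrable_mul hh
  have e : ∀ ω, (f ω - g ω + h ω) ^ 2 = (f ω ^ 2 + g ω ^ 2 + h ω ^ 2)
      + ((-2) * (f ω * g ω) + 2 * (f ω * h ω) + (-2) * (g ω * h ω)) := fun ω => by ring
  simp_rw [e]
  have i1 : Integrable (fun ω => f ω ^ 2 + g ω ^ 2) P := hf.integrable_sq.add hg.integrable_sq
  have i2 : Integrable (fun ω => f ω ^ 2 + g ω ^ 2 + h ω ^ 2) P := i1.add hh.integrable_sq
  have i3 : Integrable (fun ω => (-2) * (f ω * g ω) + 2 * (f ω * h ω)) P :=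
    (ifg.const_mul _).add (ifh.const_mul _)
  have i4 : Integrable
      (fun ω => (-2) * (f ω * g ω) + 2 * (f ω * h ω) + (-2) * (g ω * h ω)) P :=
    i3.add (igh.const_mul _)
  rw [integral_add i2 i4, integral_add i1 hh.integrable_sq,
    integral_add hf.integrable_sq hg.integrable_sq, integral_add i3 (igh.const_mul _),
    integral_add (ifg.const_mul _) (ifh.const_mul _), integral_const_mul, integral_const_mul,
    integral_const_mul, hfg, hfh, hgh]
  ring

variable {Ω : Type*} [MeasurableSpace Ω] {P : Measure Ω} [IsProbabilityMeasure P] {p : ℕ}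
  {θ : Params p} {X : Ω → Fin p → ℝ} {Y : Ω → ℝ} {Z : Ω → Fin θ.K → ℝ} {W : Ω → Fin p → ℝ}
  {ε : Ω → ℝ}

/-- The risk of the linear predictor `α` in excess of the noise level. -/
def excess (θ : Params p) (α : Fin p → ℝ) : ℝ :=
  (θ.β - θ.Aᵀ *ᵥ α) ⬝ᵥ θ.SigmaZ *ᵥ (θ.β - θ.Aᵀ *ᵥ α) + α ⬝ᵥ θ.SigmaW *ᵥ α

theorem measurable_dotProduct_right {d : ℕ} (v : Fin d → ℝ) :
    Measurable fun x : Fin d → ℝ => x ⬝ᵥ v := by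
  simp only [dotProduct]; fun_prop

theorem risk_sub_eq_excess (h : IsFRM θ X Y Z W ε P) (α : Fin p → ℝ) :
    risk X Y P α - θ.sigmaSq = excess θ α := by
  set δ := θ.β - θ.Aᵀ *ᵥ α
  have h1 : risk X Y P α = ∫ ω, (Z ω ⬝ᵥ δ - W ω ⬝ᵥ α + ε ω) ^ 2 ∂P := by
    refine integral_congr_ae ?_
    filter_upwards [h.eq_X, h.eq_Y] with ω hX hY
    have e1 : (θ.A *ᵥ Z ω) ⬝ᵥ α = Z ω ⬝ᵥ θ.Aᵀ *ᵥ α := mulVec_dotProduct _ _ _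
    simp only [δ]
    rw [hX, hY, add_dotProduct, dotProduct_sub, e1]
    ring
  have mZ : Measurable fun ω => Z ω ⬝ᵥ δ := (measurable_dotProduct_right δ).comp h.measurable_Z
  have mW : Measurable fun ω => W ω ⬝ᵥ α := (measurable_dotProduct_right α).comp h.measurable_W
  have iZW : IndepFun (fun ω => Z ω ⬝ᵥ δ) (fun ω => W ω ⬝ᵥ α) P :=
    h.indep_Z_Wε.comp (measurable_dotProduct_right δ)
      ((measurable_dotProduct_right α).comp measurable_fst)
  have iZε : IndepFun (fun ω => Z ω ⬝ᵥ δ) ε P :=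
    h.indep_Z_Wε.comp (measurable_dotProduct_right δ) measurable_snd
  have iWε : IndepFun (fun ω => W ω ⬝ᵥ α) ε P :=
    h.indep_W_ε.comp (measurable_dotProduct_right α) measurable_id
  rw [h1, integral_sq_sum_of_uncorrelated (h.cov_Z.memLp_dotProduct δ) (h.cov_W.memLp_dotProduct α)
    h.memLp_ε, h.cov_Z.integral_dotProduct_sq, h.cov_W.integral_dotProduct_sq, h.var_ε]
  · simp only [excess, δ]; ring
  · rw [iZW.integral_fun_mul_eq_mul_integral mZ.aestronglyMeasurable mW.aestronglyMeasurable,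
      h.cov_Z.integral_dotProduct, zero_mul]
  · rw [iZε.integral_fun_mul_eq_mul_integral mZ.aestronglyMeasurable
      h.measurable_ε.aestronglyMeasurable, h.cov_Z.integral_dotProduct, zero_mul]
  · rw [iWε.integral_fun_mul_eq_mul_integral mW.aestronglyMeasurable
      h.measurable_ε.aestronglyMeasurable, h.cov_W.integral_dotProduct, zero_mul]

end Risk

/-! ### From the sample to independent latent variables; measurability. -/

section Transfer

variable {Ω : Type*} [MeasurableSpace Ω] {P : Measure Ω} [IsProbabilityMeasure P] {p n : ℕ}
  {θ : Params p} {X : Ω → Fin p → ℝ} {Y : Ω → ℝ} {Z : Ω → Fin θ.K → ℝ} {W : Ω → Fin p → ℝ}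
  {ε : Ω → ℝ}

/-- The data as a function of the latent factors, the feature noise and the response noise. -/
def latentToData (θ : Params p) (q : (Fin n → Fin θ.K → ℝ) × (Fin n → Fin p → ℝ) × (Fin n → ℝ)) :
    Fin n → (Fin p → ℝ) × ℝ :=
  fun i => (θ.A *ᵥ q.1 i + q.2.1 i, q.1 i ⬝ᵥ θ.β + q.2.2 i)

theorem measurable_latentToData : Measurable (latentToData (n := n) θ) := by
  unfold latentToData
  simp only [dotProduct]
  fun_prop

theorem map_data_eq (h : IsFRM θ X Y Z W ε P) :
    P.map (fun ω => (X ω, Y ω)) = ((P.map Z).prod ((P.map W).prod (P.map ε))).map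
      fun q => (θ.A *ᵥ q.1 + q.2.1, q.1 ⬝ᵥ θ.β + q.2.2) := by
  rw [← h.indep_W_ε.map_prod_eq_prod_map_map h.measurable_W.aemeasurable
      h.measurable_ε.aemeasurable,
    ← h.indep_Z_Wε.map_prod_eq_prod_map_map h.measurable_Z.aemeasurable
      (h.measurable_W.prodMk h.measurable_ε).aemeasurable,
    Measure.map_map (by simp only [dotProduct]; fun_prop)
      (h.measurable_Z.prodMk (h.measurable_W.prodMk h.measurable_ε))]
  refine Measure.map_congr ?_
  filter_upwards [h.eq_X, h.eq_Y] with ω hX hY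
  simp [hX, hY]

theorem measurePreserving_zip {α β γ : Type*} [MeasurableSpace α] [MeasurableSpace β]
    [MeasurableSpace γ] (μ : Measure α) (ν : Measure β) (η : Measure γ) [SigmaFinite μ]
    [SigmaFinite ν] [SigmaFinite η] :
    MeasurePreserving (fun (q : (Fin n → α) × (Fin n → β) × (Fin n → γ)) i =>
        (q.1 i, q.2.1 i, q.2.2 i))
      ((Measure.pi fun _ => μ).prod ((Measure.pi fun _ => ν).prod (Measure.pi fun _ => η)))
      (Measure.pi fun _ => μ.prod (ν.prod η)) := by
  have h1 := (measurePreserving_arrowProdEquivProdArrow β γ (Fin n) (fun _ => ν) fun _ => η).symm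
  have h2 := (measurePreserving_arrowProdEquivProdArrow α (β × γ) (Fin n) (fun _ => μ)
    fun _ => ν.prod η).symm
  exact h2.comp ((MeasurePreserving.id _).prod h1)

/-- The sample space need not carry latent variables, and only the law of the data matters. That law
is the image of independent latent factors, feature noise and response noise, which allows
conditioning on them in turn. -/
theorem map_sample_eq {Ω' : Type*} [MeasurableSpace Ω'] {Q : Measure Ω'} [IsProbabilityMeasure Q]
    {Xs : Fin n → Ω' → Fin p → ℝ} {Ys : Fin n → Ω' → ℝ} (h : IsFRM θ X Y Z W ε P)
    (hs : IsSample Xs Ys Q X Y P) :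
    Q.map (fun ω i => (Xs i ω, Ys i ω)) =
      ((Measure.pi fun _ : Fin n => P.map Z).prod ((Measure.pi fun _ : Fin n => P.map W).prod
        (Measure.pi fun _ : Fin n => P.map ε))).map (latentToData θ) := by
  have : IsProbabilityMeasure (P.map Z) :=
    Measure.isProbabilityMeasure_map h.measurable_Z.aemeasurable
  have : IsProbabilityMeasure (P.map W) :=
    Measure.isProbabilityMeasure_map h.measurable_W.aemeasurable
  have : IsProbabilityMeasure (P.map ε) :=
    Measure.isProbabilityMeasure_map h.measurable_ε.aemeasurable
  rw [(iIndepFun_iff_map_fun_eq_pi_map fun i => (hs.identDistrib i).aemeasurable_fst).1 hs.indep]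
  simp_rw [fun i => (hs.identDistrib i).map_eq, map_data_eq h]
  have hF : Measurable fun q : (Fin θ.K → ℝ) × (Fin p → ℝ) × ℝ =>
      (θ.A *ᵥ q.1 + q.2.1, q.1 ⬝ᵥ θ.β + q.2.2) := by
    simp only [dotProduct]; fun_prop
  have : IsProbabilityMeasure (((P.map Z).prod ((P.map W).prod (P.map ε))).map
      fun q => (θ.A *ᵥ q.1 + q.2.1, q.1 ⬝ᵥ θ.β + q.2.2)) :=
    Measure.isProbabilityMeasure_map hF.aemeasurable
  rw [← Measure.pi_map_pi (μ := fun _ : Fin n => (P.map Z).prod ((P.map W).prod (P.map ε)))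
    (f := fun _ q => (θ.A *ᵥ q.1 + q.2.1, q.1 ⬝ᵥ θ.β + q.2.2)) fun _ => hF.aemeasurable,
    ← (measurePreserving_zip (n := n) (P.map Z) (P.map W) (P.map ε)).map_eq,
    Measure.map_map (by fun_prop) (measurePreserving_zip (P.map Z) (P.map W) (P.map ε)).measurable]
  rfl

/-- Fubini, with sections over `S` bounded by 1. A measurable hull is used because `S` need not be
measurable. -/
theorem prod_measure_le_of_sections {α β : Type*} [MeasurableSpace α] [MeasurableSpace β]
    {μ : Measure α} {ν : Measure β} [IsProbabilityMeasure μ] [IsProbabilityMeasure ν]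
    {T : Set (α × β)} (hT : MeasurableSet T) {S : Set α} {q : ENNReal}
    (h : ∀ a ∉ S, ν (Prod.mk a ⁻¹' T) ≤ q) : μ.prod ν T ≤ μ S + q := by
  rw [Measure.prod_apply hT]
  calc ∫⁻ a, ν (Prod.mk a ⁻¹' T) ∂μ
      ≤ ∫⁻ a, ((toMeasurable μ S).indicator 1 a + q) ∂μ := by
        refine lintegral_mono fun a => ?_
        by_cases ha : a ∈ toMeasurable μ S
        · rw [Set.indicator_of_mem ha]
          exact prob_le_one.trans le_self_add
        · rw [Set.indicator_of_notMem ha, zero_add]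
          exact h a fun haS => ha (subset_toMeasurable μ S haS)
    _ = μ S + q := by
        rw [lintegral_add_right _ measurable_const,
          lintegral_indicator_one (measurableSet_toMeasurable _ _), measure_toMeasurable]
        simp

theorem measurable_matrix_inv {n : ℕ} {α : Type*} [MeasurableSpace α]
    {M : α → Matrix (Fin n) (Fin n) ℝ} (hM : ∀ i j, Measurable fun a => M a i j) (i j : Fin n) :
    Measurable fun a => (M a)⁻¹ i j := by
  have hdet : ∀ {N : α → Matrix (Fin n) (Fin n) ℝ}, (∀ i j, Measurable fun a => N a i j) →
      Measurable fun a => (N a).det := fun hN => by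
    simp only [Matrix.det_apply]
    refine Finset.measurable_sum _ fun σ _ => Measurable.const_smul ?_ _
    exact Finset.measurable_prod _ fun i _ => hN _ _
  simp only [Matrix.inv_def, Matrix.smul_apply, Ring.inverse_eq_inv', smul_eq_mul,
    Matrix.adjugate_apply]
  refine (hdet hM).inv.mul (hdet fun k l => ?_)
  by_cases hk : k = j
  · subst hk; simp only [Matrix.updateRow_self]; exact measurable_const
  · simp only [Matrix.updateRow_ne hk]; exact hM k l

/-- The data sets for which the feature matrix has full row rank and the minimum-norm predictor
has excess risk at most `b`. -/
def goodData (θ : Params p) (n : ℕ) (b : ℝ) : Set (Fin n → (Fin p → ℝ) × ℝ) :=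
  {r | (Matrix.of (fun i => (r i).1) * (Matrix.of fun i => (r i).1)ᵀ).det ≠ 0 ∧
    excess θ (((Matrix.of fun i => (r i).1)ᵀ *
      (Matrix.of (fun i => (r i).1) * (Matrix.of fun i => (r i).1)ᵀ)⁻¹) *ᵥ fun i => (r i).2) ≤ b}

theorem measurableSet_goodData (θ : Params p) (n : ℕ) (b : ℝ) :
    MeasurableSet (goodData θ n b) := by
  have hg : ∀ i j, Measurable fun r : Fin n → (Fin p → ℝ) × ℝ =>
      (Matrix.of (fun i => (r i).1) * (Matrix.of fun i => (r i).1)ᵀ) i j := fun i j => by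
    simp only [Matrix.mul_apply, Matrix.of_apply, Matrix.transpose_apply]; fun_prop
  have hinv := measurable_matrix_inv hg
  have hα : Measurable fun r : Fin n → (Fin p → ℝ) × ℝ => ((Matrix.of fun i => (r i).1)ᵀ *
      (Matrix.of (fun i => (r i).1) * (Matrix.of fun i => (r i).1)ᵀ)⁻¹) *ᵥ fun i => (r i).2 := by
    refine measurable_pi_lambda _ fun k => ?_
    simp only [← Matrix.mulVec_mulVec]
    simp only [Matrix.mulVec, dotProduct, Matrix.transpose_apply, Matrix.of_apply]
    refine Finset.measurable_sum _ fun i _ => Measurable.mul (by fun_prop) ?_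
    exact Finset.measurable_sum _ fun j _ => (hinv i j).mul (by fun_prop)
  have hE : Measurable (excess θ) := by
    unfold excess
    simp only [Matrix.mulVec, dotProduct, Pi.sub_apply]
    fun_prop
  refine MeasurableSet.inter ?_ (measurableSet_le (hE.comp hα) measurable_const)
  have hdet : Measurable fun r : Fin n → (Fin p → ℝ) × ℝ =>
      (Matrix.of (fun i => (r i).1) * (Matrix.of fun i => (r i).1)ᵀ).det := by
    simp only [Matrix.det_apply]
    refine Finset.measurable_sum _ fun σ _ => Measurable.const_smul ?_ _
    exact Finset.measurable_prod _ fun i _ => hg _ _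
  exact hdet (measurableSet_singleton 0).compl

end Transfer

/-! ### Probabilities of the good events. -/

section GoodEvents

variable {Ω : Type*} [MeasurableSpace Ω] {P : Measure Ω} [IsProbabilityMeasure P] {p n : ℕ}

/-- The case g = 0 occurs when σ² = 0. It follows by applying the tail bound to g + 1/(k + 1) and
exhausting the event from inside. -/
theorem quadratic_upper_tail_of_nonneg {ι : Type*} [Fintype ι] [DecidableEq ι] {x : Ω → ι → ℝ}
    (hx : Measurable x) {g : ℝ} (hg : 0 ≤ g) (hsub : SubGaussianMoments x g P)
    {M : Matrix ι ι ℝ} (hM : M.PosSemidef) {L : ℝ} (hL0 : 0 < L)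
    (hL : ∀ y, y ⬝ᵥ M *ᵥ y ≤ L * (y ⬝ᵥ y)) {r : ℝ} (hr : 0 ≤ r) :
    P {ω | g * (2 * M.trace + 4 * L * r) < x ω ⬝ᵥ M *ᵥ x ω} ≤ ENNReal.ofReal (Real.exp (-r)) := by
  set t := 2 * M.trace + 4 * L * r
  have ht : 0 ≤ t := by have := hM.trace_nonneg; positivity
  set E : ℕ → Set Ω := fun k => {ω | (g + 1 / (k + 1)) * t < x ω ⬝ᵥ M *ᵥ x ω}
  have hE : ∀ k, P (E k) ≤ ENNReal.ofReal (Real.exp (-r)) := fun k => by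
    have hk : (0 : ℝ) < 1 / (k + 1) := by positivity
    have h := quadratic_upper_tail hx (g := g + 1 / (k + 1)) (by positivity)
      (hsub.mono (by linarith)) hM hL0 hL r
    refine le_trans (le_of_eq ?_) h
    simp only [E, t]
    congr 2; ext ω; ring_nf
  have hmono : Monotone E := fun k l hkl ω hω => by
    simp only [E, Set.mem_ofPred_eq] at hω ⊢
    refine lt_of_le_of_lt ?_ hω
    have hkl' : (k : ℝ) ≤ l := by exact_mod_cast hkl
    gcongr
  have hsubset : {ω | g * t < x ω ⬝ᵥ M *ᵥ x ω} ⊆ ⋃ k, E k := fun ω hω => by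
    simp only [Set.mem_ofPred_eq] at hω
    have hlim : Filter.Tendsto (fun k : ℕ => (g + 1 / ((k : ℝ) + 1)) * t) Filter.atTop
        (nhds ((g + 0) * t)) :=
      (tendsto_const_nhds.add tendsto_one_div_add_atTop_nhds_zero_nat).mul_const t
    rw [add_zero] at hlim
    obtain ⟨k, hk⟩ := (hlim.eventually_lt_const hω).exists
    exact Set.mem_iUnion.2 ⟨k, hk⟩
  calc _ ≤ P (⋃ k, E k) := measure_mono hsubset
    _ = ⨆ k, P (E k) := hmono.measure_iUnion
    _ ≤ _ := iSup_le hE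

/-- The sample of latent factors has a well conditioned covariance matrix. -/
def goodFactors (θ : Params p) (n : ℕ) : Set (Fin n → Fin θ.K → ℝ) :=
  {z | ∀ u, (n : ℝ) / 8 * (u ⬝ᵥ θ.SigmaZ *ᵥ u) ≤ (Matrix.of z *ᵥ u) ⬝ᵥ (Matrix.of z *ᵥ u)}

/-- The feature noise matrix is well conditioned, also after projecting its rows onto the
orthogonal complement of the column space of `A`. -/
def goodNoise (θ : Params p) (n : ℕ) (c : ℝ) : Set (Fin n → Fin p → ℝ) :=
  {w | ∀ u, ((Matrix.of w)ᵀ *ᵥ u) ⬝ᵥ ((Matrix.of w)ᵀ *ᵥ u)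
        ≤ 16 * c * θ.SigmaW.trace * (u ⬝ᵥ u) ∧
      θ.SigmaW.trace / 16 * (u ⬝ᵥ u) ≤
        (((1 - colProj θ.A) * (Matrix.of w)ᵀ) *ᵥ u) ⬝ᵥ (((1 - colProj θ.A) * (Matrix.of w)ᵀ) *ᵥ u)}

theorem measurableSet_goodFactors (θ : Params p) (n : ℕ) : MeasurableSet (goodFactors θ n) := by
  have : goodFactors θ n = ⋂ u, {z | (n : ℝ) / 8 * (u ⬝ᵥ θ.SigmaZ *ᵥ u) ≤
      (Matrix.of z *ᵥ u) ⬝ᵥ (Matrix.of z *ᵥ u)} := by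
    ext z; simp [goodFactors]
  rw [this]
  refine (isClosed_iInter fun u => isClosed_le continuous_const ?_).measurableSet
  simp only [Matrix.mulVec, dotProduct, Matrix.of_apply]
  fun_prop

theorem measurableSet_goodNoise (θ : Params p) (n : ℕ) (c : ℝ) :
    MeasurableSet (goodNoise θ n c) := by
  have : goodNoise θ n c = ⋂ u, ({w | ((Matrix.of w)ᵀ *ᵥ u) ⬝ᵥ ((Matrix.of w)ᵀ *ᵥ u)
        ≤ 16 * c * θ.SigmaW.trace * (u ⬝ᵥ u)} ∩ {w | θ.SigmaW.trace / 16 * (u ⬝ᵥ u) ≤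
        (((1 - colProj θ.A) * (Matrix.of w)ᵀ) *ᵥ u) ⬝ᵥ
          (((1 - colProj θ.A) * (Matrix.of w)ᵀ) *ᵥ u)}) := by
    ext z; simp [goodNoise]
  rw [this]
  refine (isClosed_iInter fun u => (isClosed_le ?_ continuous_const).inter
    (isClosed_le continuous_const ?_)).measurableSet
  · simp only [Matrix.mulVec, dotProduct, Matrix.transpose_apply, Matrix.of_apply]
    fun_prop
  · simp only [← Matrix.mulVec_mulVec]
    simp only [Matrix.mulVec, dotProduct, Matrix.transpose_apply, Matrix.of_apply]
    fun_prop

variable {θ : Params p} {γε γz γw : ℝ} {X : Ω → Fin p → ℝ} {Y : Ω → ℝ} {Z Zt : Ω → Fin θ.K → ℝ}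
  {W Wt : Ω → Fin p → ℝ} {ε : Ω → ℝ}

theorem pi_map_apply_eq {d : ℕ} {x : Ω → Fin d → ℝ} (hx : Measurable x)
    {S : Set (Fin n → Fin d → ℝ)} (hS : MeasurableSet S) :
    (Measure.pi fun _ : Fin n => P.map x) S
      = (Measure.pi fun _ : Fin n => P) {ω | (fun i => x (ω i)) ∈ S} := by
  have : IsProbabilityMeasure (P.map x) := Measure.isProbabilityMeasure_map hx.aemeasurable
  rw [← Measure.pi_map_pi (μ := fun _ : Fin n => P) (f := fun _ => x) fun _ => hx.aemeasurable,
    Measure.map_apply (by fun_prop) hS]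
  rfl

theorem ae_pi_forall {q : Ω → Prop} (h : ∀ᵐ ω ∂P, q ω) :
    ∀ᵐ ω ∂(Measure.pi fun _ : Fin n => P), ∀ i, q (ω i) :=
  ae_all_iff.2 fun i => (Measure.quasiMeasurePreserving_eval (fun _ : Fin n => P) i).ae h

open scoped MatrixOrder in
-- Conditioning of the isotropic rows is tested at Σ_Z^{1/2}u, which yields the Σ_Z-weighted bound
-- with no dependence on the spectrum of Σ_Z.
theorem measure_goodFactors_compl_le (h : IsSubGaussianFRM θ γε γz γw X Y Z Zt W Wt ε P)
    {c : NNReal} (hc : 1 ≤ c) (hγ : (γz ^ 2).toNNReal ≤ c) :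
    (Measure.pi fun _ : Fin n => P.map Z) (goodFactors θ n)ᶜ ≤
      ENNReal.ofReal (3 * Real.exp (θ.K * Real.log (33 * c) - n / (3072 * (c : ℝ) ^ 2))) := by
  rw [pi_map_apply_eq h.measurable_Z (measurableSet_goodFactors θ n).compl]
  refine le_trans (measure_mono_ae ?_)
    (measure_isotropic_rows_le (n := n) h.measurable_Zt h.subGaussian_Zt h.cov_Zt hc hγ)
  filter_upwards [ae_pi_forall (n := n) h.eq_Z] with ω hω
  intro hbad hgood
  apply hbad
  intro u
  set S := CFC.sqrt θ.SigmaZ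
  have hS : S * S = θ.SigmaZ := sqrt_mul_sqrt_of_posSemidef h.cov_Z.posSemidef
  have hSt : Sᵀ = S := sqrt_transpose _
  have h1 : Matrix.of (fun i => Z (ω i)) *ᵥ u = Matrix.of (fun i => Zt (ω i)) *ᵥ (S *ᵥ u) := by
    funext i
    change Z (ω i) ⬝ᵥ u = Zt (ω i) ⬝ᵥ S *ᵥ u
    rw [hω i, mulVec_dotProduct, hSt]
  have h2 := hgood (S *ᵥ u)
  rw [mulVec_dotProduct_self S, hSt, hS] at h2
  rw [h1]
  exact h2

open scoped MatrixOrder in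
-- The independent-entries bound is applied to S = Σ_W^{1/2} and to RS, with R the projection off
-- the columns of A. By `hK`, R removes at most half of the trace, whence 6144 = 2 · 3072 and the
-- fraction 1/16.
theorem measure_goodNoise_compl_le (h : IsSubGaussianFRM θ γε γz γw X Y Z Zt W Wt ε P)
    (hind : iIndepFun (fun (j : Fin p) (ω : Ω) => Wt ω j) P)
    {c : NNReal} (hc : 1 ≤ c) (hγ : (γw ^ 2).toNNReal ≤ c) (hL : 0 < opNorm θ.SigmaW)
    (hK : opNorm θ.SigmaW * θ.K ≤ θ.SigmaW.trace / 2) :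
    (Measure.pi fun _ : Fin n => P.map W) (goodNoise θ n c)ᶜ ≤
      2 * ENNReal.ofReal (3 * Real.exp (n * Real.log (33 * c)
        - θ.SigmaW.trace / (6144 * (c : ℝ) ^ 2 * opNorm θ.SigmaW))) := by
  have hc1 : (1 : ℝ) ≤ c := by exact_mod_cast hc
  set S := CFC.sqrt θ.SigmaW
  have hS : S * S = θ.SigmaW := sqrt_mul_sqrt_of_posSemidef h.cov_W.posSemidef
  have hSt : Sᵀ = S := sqrt_transpose _
  set R := 1 - colProj θ.A
  have hA := isUnit_det_gram_of_rank h.rank_A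
  have hRt : Rᵀ = R := by
    simp only [R]; rw [Matrix.transpose_sub, colProj_transpose, Matrix.transpose_one]
  have hRR : R * R = R := by
    simp only [R, Matrix.sub_mul, Matrix.mul_sub, Matrix.one_mul, Matrix.mul_one, colProj_idem hA,
      sub_self, sub_zero]
  have hτ : 0 ≤ θ.SigmaW.trace := h.cov_W.posSemidef.trace_nonneg
  have hLS := dotProduct_mulVec_le_opNorm θ.SigmaW
  have e1 : Sᵀ * S = θ.SigmaW := by rw [hSt, hS]
  have e2 : ((R * S)ᵀ * (R * S)).trace = θ.SigmaW.trace - (colProj θ.A * θ.SigmaW).trace := by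
    rw [Matrix.transpose_mul, hSt, hRt, Matrix.mul_assoc, ← Matrix.mul_assoc R R, hRR,
      Matrix.trace_mul_comm, Matrix.mul_assoc, hS]
    simp only [R]
    rw [Matrix.sub_mul, Matrix.one_mul, Matrix.trace_sub]
  have e3 : θ.SigmaW.trace / 2 ≤ ((R * S)ᵀ * (R * S)).trace := by
    have := trace_projection_mul_le colProj_transpose (colProj_idem hA) hLS
    rw [trace_colProj hA, Fintype.card_fin] at this
    rw [e2]; linarith
  have b1 := measure_independent_entries_le (n := n) h.measurable_Wt h.subGaussian_Wt h.cov_Wt hind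
    hc hγ S hL (by rw [e1]; exact hLS)
  have b2 := measure_independent_entries_le (n := n) h.measurable_Wt h.subGaussian_Wt h.cov_Wt hind
    hc hγ (R * S) hL (fun y => by
      rw [← mulVec_dotProduct_self, ← Matrix.mulVec_mulVec]
      refine (projection_bound hRt hRR _).trans ?_
      rw [mulVec_dotProduct_self, e1]; exact hLS y)
  rw [e1] at b1
  rw [pi_map_apply_eq h.measurable_W (measurableSet_goodNoise θ n c).compl, two_mul]
  refine le_trans (le_trans (measure_mono_ae ?_) (measure_union_le _ _))
    (add_le_add (b1.trans ?_) (b2.trans ?_))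
  · filter_upwards [ae_pi_forall (n := n) h.eq_W] with ω hω
    intro hbad
    by_contra hcon
    have hcon' := not_or.1 hcon
    have g1 := not_not.1 hcon'.1
    have g2 := not_not.1 hcon'.2
    apply hbad
    intro u
    have hw : (Matrix.of fun i => W (ω i))ᵀ = S * (Matrix.of fun i => Wt (ω i))ᵀ := by
      ext j i
      change W (ω i) j = _
      rw [hω i]
      rfl
    rw [hw, ← Matrix.mul_assoc]
    refine ⟨(g1 u).2, le_trans ?_ (g2 u).1⟩
    have := dotProduct_self_nonneg' u
    nlinarith
  · apply ENNReal.ofReal_le_ofReal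
    gcongr
    norm_num
  · apply ENNReal.ofReal_le_ofReal
    have : θ.SigmaW.trace / (6144 * (c : ℝ) ^ 2 * opNorm θ.SigmaW)
        = θ.SigmaW.trace / 2 / (3072 * (c : ℝ) ^ 2 * opNorm θ.SigmaW) := by
      field_simp; ring
    rw [this]
    gcongr

end GoodEvents

/-! ### Assembling the high-probability bound. -/

section Conclusion

variable {Ω : Type*} [MeasurableSpace Ω] {P : Measure Ω} {p n : ℕ}
  {θ : Params p} {γε γz γw : ℝ} {X : Ω → Fin p → ℝ} {Y : Ω → ℝ} {Z Zt : Ω → Fin θ.K → ℝ}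
  {W Wt : Ω → Fin p → ℝ} {ε : Ω → ℝ}

/-- RA = 0 gives Rxᵀ = Rwᵀ, and R is a contraction; the signal cannot lower the singular values,
whatever z is. -/
theorem lower_bound_features {z : Fin n → Fin θ.K → ℝ} {w : Fin n → Fin p → ℝ} {c : ℝ}
    (hA : IsUnit (θ.Aᵀ * θ.A).det) (hw : w ∈ goodNoise θ n c) (u : Fin n → ℝ) :
    θ.SigmaW.trace / 16 * (u ⬝ᵥ u) ≤ ((Matrix.of z * θ.Aᵀ + Matrix.of w)ᵀ *ᵥ u) ⬝ᵥ
      ((Matrix.of z * θ.Aᵀ + Matrix.of w)ᵀ *ᵥ u) := by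
  set R := 1 - colProj θ.A
  have hRt : Rᵀ = R := by
    simp only [R]; rw [Matrix.transpose_sub, colProj_transpose, Matrix.transpose_one]
  have hRR : R * R = R := by
    simp only [R, Matrix.sub_mul, Matrix.mul_sub, Matrix.one_mul, Matrix.mul_one, colProj_idem hA,
      sub_self, sub_zero]
  have hRA : R * θ.A = 0 := by
    simp only [R]; rw [Matrix.sub_mul, colProj_mul_self hA, Matrix.one_mul, sub_self]
  refine (hw u).2.trans (le_trans (le_of_eq ?_) (projection_bound hRt hRR _))
  have : R * (Matrix.of w)ᵀ = R * (Matrix.of z * θ.Aᵀ + Matrix.of w)ᵀ := by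
    rw [Matrix.transpose_add, Matrix.transpose_mul, Matrix.transpose_transpose, Matrix.mul_add,
      ← Matrix.mul_assoc, hRA, Matrix.zero_mul, zero_add]
  rw [this, ← Matrix.mulVec_mulVec]

theorem isUnit_det_gram_goodFactors (hn : 1 ≤ n) (h : IsFRM θ X Y Z W ε P)
    {z : Fin n → Fin θ.K → ℝ} (hz : z ∈ goodFactors θ n) :
    IsUnit ((Matrix.of z)ᵀ * Matrix.of z).det := by
  have hn0 : (0 : ℝ) < n := by exact_mod_cast hn
  rw [isUnit_iff_ne_zero]
  intro hdet
  obtain ⟨v, hv, hzv⟩ := Matrix.exists_mulVec_eq_zero_iff.2 hdet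
  have h1 := hz v
  rw [mulVec_dotProduct_self, hzv, dotProduct_zero] at h1
  have h2 := posSemidef_dotProduct_nonneg h.cov_Z.posSemidef v
  have h3 : v ⬝ᵥ θ.SigmaZ *ᵥ v = 0 := by
    refine le_antisymm ?_ h2
    by_contra hcon
    push Not at hcon
    have : 0 < (n : ℝ) / 8 * (v ⬝ᵥ θ.SigmaZ *ᵥ v) := by positivity
    linarith
  have h4 : θ.SigmaZ *ᵥ v = 0 := by
    have := (h.cov_Z.posSemidef.dotProduct_mulVec_zero_iff v).1 (by simpa using h3)
    exact this
  exact hv (eq_zero_of_mulVec_eq_zero_of_rank h.rank_SigmaZ h4)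

theorem latentToData_mem_goodData (hn : 1 ≤ n) (h : IsFRM θ X Y Z W ε P) {c : ℝ} (hc : 0 ≤ c)
    (hτ : 0 < θ.SigmaW.trace) {z : Fin n → Fin θ.K → ℝ} {w : Fin n → Fin p → ℝ} {e : Fin n → ℝ}
    (hz : z ∈ goodFactors θ n) (hw : w ∈ goodNoise θ n c) {t₁ t₂ b : ℝ}
    (h1 : e ⬝ᵥ noiseForm (Matrix.of z) (Matrix.of w) θ.A *ᵥ e ≤ t₁) (h2 : e ⬝ᵥ e ≤ t₂)
    (hb : 4 * (1 + 256 * c) * (128 * c * θ.SigmaW.trace / n + opNorm θ.SigmaW) *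
          (θ.β ⬝ᵥ (θ.Aᵀ * θ.A)⁻¹ *ᵥ θ.β)
        + 16 / n * t₁ + 32 * opNorm θ.SigmaW / θ.SigmaW.trace * t₂ ≤ b) :
    latentToData θ (z, w, e) ∈ goodData θ n b := by
  have hn0 : (0 : ℝ) < n := by exact_mod_cast hn
  have hA := isUnit_det_gram_of_rank h.rank_A
  have hx := lower_bound_features (z := z) hA hw
  have hzu := isUnit_det_gram_goodFactors hn h hz
  set x := Matrix.of z * θ.Aᵀ + Matrix.of w with hxdef
  have ex : (Matrix.of fun i => (latentToData θ (z, w, e) i).1) = x := by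
    ext i j
    simp only [latentToData, Matrix.of_apply, Pi.add_apply, hxdef, Matrix.add_apply,
      Matrix.mul_apply, Matrix.transpose_apply, Matrix.mulVec, dotProduct]
    congr 1
    exact Finset.sum_congr rfl fun k _ => mul_comm _ _
  have ey : (fun i => (latentToData θ (z, w, e) i).2) = Matrix.of z *ᵥ θ.β + e := rfl
  have hxu : IsUnit (x * xᵀ).det := by
    simpa using isUnit_det_of_lower_bound (G := xᵀ) (by positivity) hx
  refine ⟨by rw [ex]; exact isUnit_iff_ne_zero.1 hxu, ?_⟩
  rw [ex, ey, ← pinv_eq hxu]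
  -- Here B/a = 256c is free of the dimension, which keeps the final constant dependent on the
  -- sub-Gaussian constants only.
  have hex := excess_le (β := θ.β) (SZ := θ.SigmaZ) (SW := θ.SigmaW) (N := (n : ℝ) / 8)
    (L := opNorm θ.SigmaW) (a := θ.SigmaW.trace / 16) (B := 16 * c * θ.SigmaW.trace)
    (by positivity) (by positivity) (opNorm_nonneg _) hA hzu hx (fun u => (hw u).1) hz
    (by positivity) (dotProduct_mulVec_le_opNorm _) e rfl
  refine hex.trans (le_trans ?_ hb)
  have e1 : 16 * c * θ.SigmaW.trace / (θ.SigmaW.trace / 16) = 256 * c := by field_simp; ring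
  have e2 : 16 * c * θ.SigmaW.trace / ((n : ℝ) / 8) = 128 * c * θ.SigmaW.trace / n := by
    field_simp; ring
  have e3 : 2 / ((n : ℝ) / 8) = 16 / n := by field_simp; ring
  have e4 : 2 * opNorm θ.SigmaW / (θ.SigmaW.trace / 16)
      = 32 * opNorm θ.SigmaW / θ.SigmaW.trace := by field_simp; ring
  rw [e1, e2, e3, e4]
  have := opNorm_nonneg θ.SigmaW
  gcongr

variable [IsProbabilityMeasure P]

theorem goodData_imp_risk_le {b : ℝ} (h : IsFRM θ X Y Z W ε P) {x : Fin n → Fin p → ℝ}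
    {y : Fin n → ℝ} (hr : (fun i => (x i, y i)) ∈ goodData θ n b) :
    risk X Y P (glsCoef x y) - θ.sigmaSq ≤ b := by
  rw [risk_sub_eq_excess h, glsCoef, pinv_eq (isUnit_iff_ne_zero.2 hr.1)]
  exact hr.2

theorem subGaussianMoments_errors {c : NNReal} (hm : Measurable ε) (hε : HasSubgaussianMGF ε c P) :
    SubGaussianMoments (fun e : Fin n → ℝ => e) c (Measure.pi fun _ => P.map ε) := by
  have : IsProbabilityMeasure (P.map ε) := Measure.isProbabilityMeasure_map hm.aemeasurable
  have h1 : HasSubgaussianMGF id c (P.map ε) :=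
    (HasSubgaussianMGF.id_map_iff hm.aemeasurable).2 hε
  exact subGaussianMoments_of_iIndepFun
    (iIndepFun_pi (X := fun (_ : Fin n) (t : ℝ) => t) fun _ => aemeasurable_id)
    fun i => hasSubgaussianMGF_eval h1 i

/-- For well conditioned latent factors and feature noise, the data set is good with high
probability over the response noise. -/
theorem measure_errors_le (hn : 1 ≤ n) (h : IsSubGaussianFRM θ γε γz γw X Y Z Zt W Wt ε P)
    {c : ℝ} (hc : 0 ≤ c) (hσ : 0 ≤ θ.sigmaSq) (hτ : 0 < θ.SigmaW.trace)
    {z : Fin n → Fin θ.K → ℝ} {w : Fin n → Fin p → ℝ} (hz : z ∈ goodFactors θ n)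
    (hw : w ∈ goodNoise θ n c) {b : ℝ}
    (hb : 4 * (1 + 256 * c) * (128 * c * θ.SigmaW.trace / n + opNorm θ.SigmaW) *
          (θ.β ⬝ᵥ (θ.Aᵀ * θ.A)⁻¹ *ᵥ θ.β)
        + 16 / n * (θ.sigmaSq * γε ^ 2 * (8 * (256 * c + 1) * (θ.K + Real.log n)))
        + 32 * opNorm θ.SigmaW / θ.SigmaW.trace * (θ.sigmaSq * γε ^ 2 * (6 * n)) ≤ b) :
    (Measure.pi fun _ : Fin n => P.map ε) {e | latentToData θ (z, w, e) ∉ goodData θ n b} ≤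
      2 * ENNReal.ofReal (1 / n) := by
  have hn0 : (0 : ℝ) < n := by exact_mod_cast hn
  have hlog : 0 ≤ Real.log n := Real.log_nonneg (by exact_mod_cast hn)
  have : IsProbabilityMeasure (P.map ε) :=
    Measure.isProbabilityMeasure_map h.measurable_ε.aemeasurable
  have hsub := subGaussianMoments_errors (n := n) h.measurable_ε h.subGaussian_ε
  set g := θ.sigmaSq * γε ^ 2
  have hg : 0 ≤ g := by positivity
  rw [Real.coe_toNNReal _ hg] at hsub
  have hA := isUnit_det_gram_of_rank h.rank_A
  have hzu := isUnit_det_gram_goodFactors hn h.toIsFRM hz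
  obtain ⟨f1, f2⟩ := noiseForm_bounds (a := θ.SigmaW.trace / 16) (B := 16 * c * θ.SigmaW.trace)
    (by positivity) (by positivity) hzu (lower_bound_features (z := z) hA hw) (fun u => (hw u).1)
  have e1 : 16 * c * θ.SigmaW.trace / (θ.SigmaW.trace / 16) = 256 * c := by field_simp; ring
  rw [e1] at f1 f2
  have hpsd : (noiseForm (Matrix.of z) (Matrix.of w) θ.A).PosSemidef :=
    transpose_mul_self_posSemidef _
  -- Both tails are taken at level r = log n, so each fails with probability 1/n.
  have b1 := quadratic_upper_tail_of_nonneg measurable_id' hg hsub hpsd (by positivity) f1 hlog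
  have b2 := quadratic_upper_tail_of_nonneg measurable_id' hg hsub
    (Matrix.PosSemidef.one : (1 : Matrix (Fin n) (Fin n) ℝ).PosSemidef) one_pos
    (fun y => by simp) hlog
  rw [Real.exp_neg, Real.exp_log hn0, ← one_div] at b1 b2
  refine le_trans (measure_mono fun e he => ?_)
    ((measure_union_le _ _).trans ((add_le_add b1 b2).trans (le_of_eq (two_mul _).symm)))
  by_contra hcon
  simp only [Set.mem_union, Set.mem_ofPred_eq, not_or, not_lt] at hcon he
  obtain ⟨c1, c2⟩ := hcon
  rw [Matrix.one_mulVec] at c2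
  refine he (latentToData_mem_goodData hn h.toIsFRM hc hτ hz hw (c1.trans ?_) (c2.trans ?_) hb)
  · refine mul_le_mul_of_nonneg_left ?_ hg
    nlinarith [mul_nonneg (mul_nonneg (show (0 : ℝ) ≤ 256 by norm_num) hc) (Nat.cast_nonneg (α := ℝ) θ.K),
      Nat.cast_nonneg (α := ℝ) θ.K]
  · refine mul_le_mul_of_nonneg_left ?_ hg
    rw [Matrix.trace_one, Fintype.card_fin]
    have := Real.log_le_self hn0.le
    linarith

/-- Union bound over the latent factors, the feature noise and the response noise. -/
theorem one_sub_le_measure_risk {Ω' : Type*} [MeasurableSpace Ω'] {Q : Measure Ω'}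
    [IsProbabilityMeasure Q] {Xs : Fin n → Ω' → Fin p → ℝ} {Ys : Fin n → Ω' → ℝ}
    (h : IsFRM θ X Y Z W ε P) (hs : IsSample Xs Ys Q X Y P) {b c q₁ q₂ q₃ : ℝ} (h1 : 0 ≤ q₁)
    (h2 : 0 ≤ q₂) (h3 : 0 ≤ q₃)
    (hz : (Measure.pi fun _ : Fin n => P.map Z) (goodFactors θ n)ᶜ ≤ ENNReal.ofReal q₁)
    (hw : (Measure.pi fun _ : Fin n => P.map W) (goodNoise θ n c)ᶜ ≤ ENNReal.ofReal q₂)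
    (he : ∀ z ∈ goodFactors θ n, ∀ w ∈ goodNoise θ n c,
      (Measure.pi fun _ : Fin n => P.map ε) {e | latentToData θ (z, w, e) ∉ goodData θ n b} ≤
        ENNReal.ofReal q₃) :
    1 - (q₁ + q₂ + q₃) ≤ Q.real {ω |
      risk X Y P (glsCoef (fun i => Xs i ω) (fun i => Ys i ω)) - θ.sigmaSq ≤ b} := by
  have : IsProbabilityMeasure (P.map Z) :=
    Measure.isProbabilityMeasure_map h.measurable_Z.aemeasurable
  have : IsProbabilityMeasure (P.map W) :=
    Measure.isProbabilityMeasure_map h.measurable_W.aemeasurable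
  have : IsProbabilityMeasure (P.map ε) :=
    Measure.isProbabilityMeasure_map h.measurable_ε.aemeasurable
  have hG := measurableSet_goodData θ n b
  set μ := (Measure.pi fun _ : Fin n => P.map Z).prod ((Measure.pi fun _ : Fin n => P.map W).prod
        (Measure.pi fun _ : Fin n => P.map ε))
  have hT : MeasurableSet (latentToData θ ⁻¹' (goodData θ n b)ᶜ) :=
    measurable_latentToData hG.compl
  have hμ : μ (latentToData θ ⁻¹' (goodData θ n b)ᶜ) ≤ ENNReal.ofReal (q₁ + q₂ + q₃) := by
    rw [add_assoc, ENNReal.ofReal_add h1 (by positivity), ENNReal.ofReal_add h2 h3]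
    refine (prod_measure_le_of_sections hT (S := (goodFactors θ n)ᶜ) fun z hzg => ?_).trans
      (add_le_add_left hz _)
    refine (prod_measure_le_of_sections (measurable_prodMk_left hT)
      (S := (goodNoise θ n c)ᶜ) fun w hwg => ?_).trans (add_le_add_left hw _)
    exact he z (not_not.1 hzg) w (not_not.1 hwg)
  set D : Ω' → Fin n → (Fin p → ℝ) × ℝ := fun ω i => (Xs i ω, Ys i ω)
  have hD : AEMeasurable D Q :=
    aemeasurable_pi_lambda _ fun i => (hs.identDistrib i).aemeasurable_fst
  have hQ : Q (D ⁻¹' (goodData θ n b)ᶜ) ≤ ENNReal.ofReal (q₁ + q₂ + q₃) := by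
    rw [← Measure.map_apply_of_aemeasurable hD hG.compl, map_sample_eq h hs,
      Measure.map_apply measurable_latentToData hG.compl]
    exact hμ
  have hQr : Q.real (D ⁻¹' (goodData θ n b)ᶜ) ≤ q₁ + q₂ + q₃ :=
    ENNReal.toReal_le_of_le_ofReal (by positivity) hQ
  have hcompl : 1 ≤ Q.real (D ⁻¹' goodData θ n b) + Q.real (D ⁻¹' (goodData θ n b)ᶜ) := by
    rw [Set.preimage_compl, ← probReal_univ (μ := Q), ← Set.union_compl_self (D ⁻¹' goodData θ n b)]
    exact measureReal_union_le _ _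
  have hmono : Q.real (D ⁻¹' goodData θ n b) ≤ Q.real {ω |
      risk X Y P (glsCoef (fun i => Xs i ω) (fun i => Ys i ω)) - θ.sigmaSq ≤ b} :=
    measureReal_mono fun ω hω => goodData_imp_risk_le h hω
  linarith

end Conclusion

/-! ### Numerical constants and the final statement. -/

/-- The constant is chosen so that n/(3072c²) ≥ K log n (2l + 1) with l = log(33c). As log n ≥ 1/2
and K ≥ 1, this is at least Kl + log n. -/
theorem factors_failure_le {n K : ℕ} {c : ℝ} (hn : 2 ≤ n) (hK : 1 ≤ K) (hc : 1 ≤ c)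
    (h : (K : ℝ) * Real.log n ≤ 1 / (3072 * c ^ 2 * (2 * Real.log (33 * c) + 1)) * n) :
    Real.exp (K * Real.log (33 * c) - n / (3072 * c ^ 2)) ≤ 1 / n := by
  have hn0 : (0 : ℝ) < n := by exact_mod_cast (by omega : 0 < n)
  have hl : 0 ≤ Real.log (33 * c) := Real.log_nonneg (by linarith)
  have hK1 : (1 : ℝ) ≤ K := by exact_mod_cast hK
  have hlog : 1 / 2 ≤ Real.log n := by
    have := Real.log_le_log two_pos (show (2 : ℝ) ≤ n by exact_mod_cast hn)
    linarith [Real.log_two_gt_d9]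
  have h1 : K * Real.log n * (2 * Real.log (33 * c) + 1) ≤ n / (3072 * c ^ 2) := by
    calc _ ≤ 1 / (3072 * c ^ 2 * (2 * Real.log (33 * c) + 1)) * n *
          (2 * Real.log (33 * c) + 1) := by gcongr
      _ = _ := by
        generalize Real.log (33 * c) = l at hl
        field_simp
  have h2 : 1 / 2 * (K * Real.log (33 * c)) ≤ Real.log n * (K * Real.log (33 * c)) := by gcongr
  have h3 : 1 * Real.log n ≤ K * Real.log n := by gcongr
  calc _ ≤ Real.exp (-Real.log n) := Real.exp_le_exp.2 (by linarith)
    _ = 1 / n := by rw [Real.exp_neg, Real.exp_log hn0, one_div]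

theorem noise_failure_le {n : ℕ} {c τ L : ℝ} (hn : 1 ≤ n) (hc : 1 ≤ c) (hL : 0 < L)
    (h : 6144 * c ^ 2 * (Real.log (33 * c) + 1) * n ≤ τ / L) :
    Real.exp (n * Real.log (33 * c) - τ / (6144 * c ^ 2 * L)) ≤ 1 / n := by
  have hn0 : (0 : ℝ) < n := by exact_mod_cast hn
  have h1 : (Real.log (33 * c) + 1) * n ≤ τ / (6144 * c ^ 2 * L) := by
    have h2 : τ / (6144 * c ^ 2 * L) = τ / L / (6144 * c ^ 2) := by field_simp
    rw [h2, le_div_iff₀ (by positivity)]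
    linarith
  calc _ ≤ Real.exp (-Real.log n) := Real.exp_le_exp.2 (by linarith [Real.log_le_self hn0.le])
    _ = 1 / n := by rw [Real.exp_neg, Real.exp_log hn0, one_div]

/-- Since n ≤ τ/L, the contribution of L to the coefficient of `bb` is absorbed into τ/n, which is
(τ/L)/n · L. -/
theorem bound_combination {n κ c g σ τ L bb : ℝ} (hn : 0 < n) (hc : 0 ≤ c) (hL : 0 < L)
    (hτ : n ≤ τ / L) (hκ : 0 ≤ κ) (hσ : 0 ≤ σ) (hbb : 0 ≤ bb) :
    4 * (1 + 256 * c) * (128 * c * τ / n + L) * bb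
        + 16 / n * (σ * g ^ 2 * (8 * (256 * c + 1) * κ)) + 32 * L / τ * (σ * g ^ 2 * (6 * n)) ≤
      (128 * (256 * c + 1) * g ^ 2 + 192 * g ^ 2 + 4 * (1 + 256 * c) * (128 * c + 1)) *
        (κ / n * σ + n / (τ / L) * σ + τ / L / n * L * bb) := by
  have hr : 0 < τ / L := hn.trans_le hτ
  have hτ0 : 0 < τ := by rwa [div_pos_iff_of_pos_right hL] at hr
  have h1 : L ≤ τ / n := by
    rw [le_div_iff₀ hL] at hτ
    rw [le_div_iff₀ hn]; linarith
  have e1 : τ / L / n * L * bb = τ / n * bb := by field_simp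
  have e2 : 16 / n * (σ * g ^ 2 * (8 * (256 * c + 1) * κ))
      = 128 * (256 * c + 1) * g ^ 2 * (κ / n * σ) := by ring
  have e3 : 32 * L / τ * (σ * g ^ 2 * (6 * n)) = 192 * g ^ 2 * (n / (τ / L) * σ) := by
    field_simp; ring
  have h2 : 4 * (1 + 256 * c) * (128 * c * τ / n + L) * bb ≤
      4 * (1 + 256 * c) * (128 * c + 1) * (τ / n * bb) := by
    calc _ ≤ 4 * (1 + 256 * c) * (128 * c * τ / n + τ / n) * bb := by gcongr
      _ = _ := by ring
  rw [e1, e2, e3]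
  have k1 : 0 ≤ κ / n * σ := by positivity
  have k2 : 0 ≤ n / (τ / L) * σ := by positivity
  have k3 : 0 ≤ τ / n * bb := by positivity
  have a1 : 0 ≤ 128 * (256 * c + 1) * g ^ 2 := by positivity
  have a2 : 0 ≤ 192 * g ^ 2 := by positivity
  have a3 : 0 ≤ 4 * (1 + 256 * c) * (128 * c + 1) := by positivity
  have := mul_nonneg a1 (add_nonneg k2 k3)
  have := mul_nonneg a2 (add_nonneg k1 k3)
  have := mul_nonneg a3 (add_nonneg k1 k2)
  linarith

/-- For K = 0 the condition on K log n says nothing about n, so the exponential bound could exceed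
1/n; the event is then certain. -/
theorem goodFactors_eq_univ {p : ℕ} {θ : Params p} (n : ℕ) (hK : θ.K = 0) :
    goodFactors θ n = Set.univ := by
  have : IsEmpty (Fin θ.K) := by rw [hK]; infer_instance
  refine Set.eq_univ_of_forall fun z u => ?_
  simp only [dotProduct, Finset.univ_eq_empty, Finset.sum_empty, mul_zero]
  exact Finset.sum_nonneg fun i _ => mul_self_nonneg _

end FactorRegression

open FactorRegression in
theorem corollary6 :
    ∃ c : ℝ, 0 < c ∧
    ∀ γz : ℝ, 0 < γz → ∃ C : ℝ, 0 < C ∧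
    ∀ γw : ℝ, 0 < γw → ∃ C' : ℝ, 0 < C' ∧
    ∀ γε : ℝ, 0 < γε → ∃ D : ℝ, 0 < D ∧
    ∀ (n p : ℕ), 1 ≤ n →
    ∀ (θ : FactorRegression.Params p),
      (θ.K : ℝ) * Real.log n ≤ C * n →
      C' * n < FactorRegression.effRank θ.SigmaW →
    ∀ (Ω : Type*) [MeasurableSpace Ω] (P : Measure Ω) [IsProbabilityMeasure P]
      (X : Ω → Fin p → ℝ) (Y : Ω → ℝ) (Z Zt : Ω → Fin θ.K → ℝ) (W Wt : Ω → Fin p → ℝ) (ε : Ω → ℝ),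
      FactorRegression.IsSubGaussianFRM θ γε γz γw X Y Z Zt W Wt ε P →
      iIndepFun (fun (j : Fin p) (ω : Ω) => Wt ω j) P →
    ∀ (Ω' : Type*) [MeasurableSpace Ω'] (Q : Measure Ω') [IsProbabilityMeasure Q]
      (Xs : Fin n → Ω' → Fin p → ℝ) (Ys : Fin n → Ω' → ℝ),
      FactorRegression.IsSample Xs Ys Q X Y P →
      1 - c / n ≤ Q.real {ω |
        FactorRegression.risk X Y P
            (FactorRegression.glsCoef (fun i => Xs i ω) (fun i => Ys i ω)) - θ.sigmaSq ≤
          D * ((θ.K + Real.log n) / n * θ.sigmaSq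
            + n / FactorRegression.effRank θ.SigmaW * θ.sigmaSq
            + FactorRegression.effRank θ.SigmaW / n * FactorRegression.opNorm θ.SigmaW
                * (θ.β ⬝ᵥ ((θ.Aᵀ * θ.A)⁻¹ *ᵥ θ.β)))} := by
  -- 11 = 3 + 6 + 2: latent factors, feature noise (two events) and response noise.
  refine ⟨11, by norm_num, fun γz _ => ?_⟩
  obtain ⟨cz, hcz, hγz⟩ : ∃ c : NNReal, 1 ≤ c ∧ (γz ^ 2).toNNReal ≤ c :=
    ⟨max 1 _, le_max_left _ _, le_max_right _ _⟩
  have hcz1 : (1 : ℝ) ≤ cz := by exact_mod_cast hcz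
  have hlz : 0 ≤ Real.log (33 * cz) := Real.log_nonneg (by linarith)
  -- The bound by 1 gives K ≤ 2n once log n ≥ 1/2; together with r_e ≥ 4n this yields ‖Σ_W‖K ≤ tr
  -- Σ_W/2.
  refine ⟨min 1 (1 / (3072 * (cz : ℝ) ^ 2 * (2 * Real.log (33 * cz) + 1))),
    lt_min one_pos (by positivity), fun γw _ => ?_⟩
  obtain ⟨cw, hcw, hγw⟩ : ∃ c : NNReal, 1 ≤ c ∧ (γw ^ 2).toNNReal ≤ c :=
    ⟨max 1 _, le_max_left _ _, le_max_right _ _⟩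
  have hcw1 : (1 : ℝ) ≤ cw := by exact_mod_cast hcw
  have hlw : 0 ≤ Real.log (33 * cw) := Real.log_nonneg (by linarith)
  refine ⟨6144 * (cw : ℝ) ^ 2 * (Real.log (33 * cw) + 1), by positivity, fun γε _ => ?_⟩
  refine ⟨128 * (256 * (cw : ℝ) + 1) * γε ^ 2 + 192 * γε ^ 2
    + 4 * (1 + 256 * (cw : ℝ)) * (128 * cw + 1), by positivity, ?_⟩
  intro n p hn θ hK hr Ω _ P _ X Y Z Zt W Wt ε h hind Ω' _ Q _ Xs Ys hs
  have hn0 : (0 : ℝ) < n := by exact_mod_cast hn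
  -- For n = 1 the claimed probability 1 - 11 is negative; this also secures log n ≥ 1/2 in the
  -- other case.
  rcases hn.eq_or_lt with rfl | hn2
  · exact le_trans (by norm_num) measureReal_nonneg
  have hC'4 : 4 ≤ 6144 * (cw : ℝ) ^ 2 * (Real.log (33 * cw) + 1) := by nlinarith
  have hr4 : 4 * (n : ℝ) ≤ effRank θ.SigmaW := by nlinarith
  have hL := opNorm_pos_of_effRank_pos (S := θ.SigmaW) (by linarith)
  have hlog : 1 / 2 ≤ Real.log n := by
    have := Real.log_le_log two_pos (show (2 : ℝ) ≤ n by exact_mod_cast hn2)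
    linarith [Real.log_two_gt_d9]
  have hKn : (θ.K : ℝ) ≤ 2 * n := by
    have h1 : (θ.K : ℝ) * Real.log n ≤ 1 * n :=
      hK.trans (mul_le_mul_of_nonneg_right (min_le_left _ _) hn0.le)
    have h2 : (θ.K : ℝ) * (1 / 2) ≤ θ.K * Real.log n := by gcongr
    linarith
  have hσ : 0 ≤ θ.sigmaSq := h.var_ε ▸ integral_nonneg fun ω => sq_nonneg _
  have hτ : 0 < θ.SigmaW.trace := by
    have : 0 < θ.SigmaW.trace / opNorm θ.SigmaW := lt_of_lt_of_le (by linarith) hr4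
    rwa [div_pos_iff_of_pos_right hL] at this
  have hKL : opNorm θ.SigmaW * θ.K ≤ θ.SigmaW.trace / 2 := by
    rw [effRank, le_div_iff₀ hL] at hr4
    nlinarith
  have hbb : 0 ≤ θ.β ⬝ᵥ (θ.Aᵀ * θ.A)⁻¹ *ᵥ θ.β :=
    posSemidef_dotProduct_nonneg (transpose_mul_self_posSemidef θ.A).inv _
  have hfactors : (Measure.pi fun _ : Fin n => P.map Z) (goodFactors θ n)ᶜ ≤
      ENNReal.ofReal (3 * (1 / n)) := by
    rcases Nat.eq_zero_or_pos θ.K with hK0 | hKpos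
    · rw [goodFactors_eq_univ n hK0, Set.compl_univ, measure_empty]
      exact zero_le
    · refine (measure_goodFactors_compl_le h hcz hγz).trans (ENNReal.ofReal_le_ofReal ?_)
      have := factors_failure_le hn2 hKpos hcz1
        (hK.trans (mul_le_mul_of_nonneg_right (min_le_right _ _) hn0.le))
      linarith
  have hnoise : (Measure.pi fun _ : Fin n => P.map W) (goodNoise θ n cw)ᶜ ≤
      ENNReal.ofReal (2 * (3 * (1 / n))) := by
    refine (measure_goodNoise_compl_le h hind hcw hγw hL hKL).trans ?_
    rw [ENNReal.ofReal_mul two_pos.le, ENNReal.ofReal_ofNat]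
    have := noise_failure_le hn hcw1 hL hr.le
    gcongr
  have herrors := fun z (hz : z ∈ goodFactors θ n) w (hw : w ∈ goodNoise θ n cw) =>
    (measure_errors_le hn h cw.2 hσ hτ hz hw
      (bound_combination (κ := θ.K + Real.log n) hn0 cw.2 hL (le_trans (by linarith) hr4)
        (by positivity) hσ hbb)).trans
      (le_of_eq (by rw [ENNReal.ofReal_mul two_pos.le, ENNReal.ofReal_ofNat] :
        _ = ENNReal.ofReal (2 * (1 / n))))
  refine le_trans (le_of_eq ?_) (one_sub_le_measure_risk h.toIsFRM hs (by positivity)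
    (by positivity) (by positivity) hfactors hnoise herrors)
  ring
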